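/- Let $\mathcal H$ be a separable real Hilbert space (of finite or countably infinite dimension), let $\mathcal D$ be a probability distribution of $(x,y)\in\mathcal H\times\mathbb R$, and let $L(w)=\tfrac12\,\mathbb E_{(x,y)\sim\mathcal D}\big[(y-\langle w,x\rangle)^2\big]$. Assume: 1. $\mathbb E\|x\|^2$, $\mathbb E\|x\|^4$ and $\mathbb E[y^2]$ are finite, $H:=\mathbb E[xx^\top]$ is strictly positive definite with finite trace, and $L$ has a unique global minimizer $w^*$. Write $H=\sum_i\lambda_i v_iv_i^\top$ with $(v_i)_{i\ge1}$ an orthonormal eigenbasis and the eigenvalues $\lambda_1\ge\lambda_2\ge\cdots$ repeated according to multiplicity. 2. $\alpha>0$ is a constant such that $\mathbb E[xx^\top A\,xx^\top]\preceq\alpha\,\mathrm{tr}(HA)\,H$ for every bounded positive semidefinite operator $A$. 3. $\Sigma:=\mathbb E\big[(y-\langle w^*,x\rangle)^2xx^\top\big]$ and $\sigma^2:=\|H^{-1/2}\Sigma H^{-1/2}\|_2$ exist and are finite. Let $N\ge1$, $w_0\in\mathcal H$, let $(x_t,y_t)_{t\ge1}$ be i.i.d. with law $\mathcal D$, and run SGD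 $$w_t=w_{t-1}+\gamma\,(y_t-\langle w_{t-1},x_t\rangle)\,x_t$$ with the constant stepsize $\gamma=1/(2\alpha\sum_i\lambda_i)$. Put $\overline w_N=\frac1N\sum_{t=0}^{N-1}w_t$. Then $L(\overline w_N)$ is integrable and $$\mathbb E[L(\overline w_N)]-L(w^*)\le 2\cdot\mathrm{EffectiveBias}+2\cdot\mathrm{EffectiveVar},$$ where $$\mathrm{EffectiveBias}=\frac{4\alpha^2(\sum_i\lambda_i)^2}{N^2}\sum_{i\le k^*}\frac{\langle v_i,w_0-w^*\rangle^2}{\lambda_i}+\sum_{i>k^*}\lambda_i\langle v_i,w_0-w^*\rangle^2,$$ $$\mathrm{EffectiveVar}=\Big(2\sigma^2+\frac{\alpha^2(\sum_i\lambda_i)\,\|w_0-w^*\|^2}{N}\Big)\Big(\frac{k^*}{N}+\frac{N\sum_{i>k^*}\lambda_i^2}{4\alpha^2(\sum_i\lambda_i)^2}\Big),$$ and $k^*=\max\{k\ge1:\lambda_k\ge 2\alpha\sum_i\lambda_i/N\}$, with $k^*=0$ if there is no such $k$. -/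

import Mathlib

open MeasureTheory ProbabilityTheory
open scoped InnerProductSpace

namespace LinRegSGD

noncomputable section

/-- Index set of an eigenbasis of a Hilbert space of dimension `d`, finite or countably infinite:
`{0, …, d - 1}` if `d < ∞` and all of `ℕ` if `d = ∞`. The `k`-th eigenvalue in the usual
one-based numbering is the one with index `k - 1`. -/
abbrev Idx (d : ℕ∞) : Type := {i : ℕ // (i : ℕ∞) < d}

section Model

/-- The population risk `L(w) = (1/2) E_{(x,y) ~ D} (y - ⟨w, x⟩)²`. -/
def risk {E : Type*} [NormedAddCommGroup E] [InnerProductSpace ℝ E] [MeasurableSpace E]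
    (D : Measure (E × ℝ)) (w : E) : ℝ :=
  (1 / 2) * ∫ z, (z.2 - ⟪w, z.1⟫_ℝ) ^ 2 ∂D

/-- The operator `x xᵀ`, that is `u ↦ ⟨x, u⟩ x`. -/
def outer {E : Type*} [NormedAddCommGroup E] [InnerProductSpace ℝ E] (x : E) : E →L[ℝ] E :=
  InnerProductSpace.rankOne ℝ x x

/-- The second moment operator `H = E[x xᵀ]`. -/
def secondMoment {E : Type*} [NormedAddCommGroup E] [InnerProductSpace ℝ E] [MeasurableSpace E]
    (D : Measure (E × ℝ)) : E →L[ℝ] E :=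
  ∫ z, outer z.1 ∂D

/-- The fourth moment operator applied to `A`, that is `E[x xᵀ A x xᵀ]`. -/
def fourthMoment {E : Type*} [NormedAddCommGroup E] [InnerProductSpace ℝ E] [MeasurableSpace E]
    (D : Measure (E × ℝ)) (A : E →L[ℝ] E) : E →L[ℝ] E :=
  ∫ z, outer z.1 ∘L A ∘L outer z.1 ∂D

/-- The gradient noise covariance at `wstar`, that is `Σ = E[(y - ⟨wstar, x⟩)² x xᵀ]`. -/
def noiseCov {E : Type*} [NormedAddCommGroup E] [InnerProductSpace ℝ E] [MeasurableSpace E]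
    (D : Measure (E × ℝ)) (wstar : E) : E →L[ℝ] E :=
  ∫ z, (z.2 - ⟪wstar, z.1⟫_ℝ) ^ 2 • outer z.1 ∂D

/-- The trace `∑ᵢ ⟨bᵢ, T bᵢ⟩` of an operator computed in the Hilbert basis `b`. It is used for
trace class operators only, for which it does not depend on `b`. -/
def traceIn {E ι : Type*} [NormedAddCommGroup E] [InnerProductSpace ℝ E]
    (b : HilbertBasis ι ℝ E) (T : E →L[ℝ] E) : ℝ :=
  ∑' i, ⟪b i, T (b i)⟫_ℝ

/-- Regularity conditions: the second and fourth moments of `x` (as tensors) and the second moment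
of `y` exist and are finite, `H` is strictly positive definite, and `wstar` is the unique global
minimizer of the risk. -/
structure Regularity {E : Type*} [NormedAddCommGroup E] [InnerProductSpace ℝ E]
    [MeasurableSpace E] (D : Measure (E × ℝ)) (wstar : E) : Prop where
  integrable_sq : Integrable (fun z => ‖z.1‖ ^ 2) D
  integrable_fourth : Integrable (fun z => ‖z.1‖ ^ 4) D
  integrable_response : Integrable (fun z => z.2 ^ 2) D
  posDef : ∀ u : E, u ≠ 0 → 0 < ⟪u, secondMoment D u⟫_ℝ
  optimal : ∀ w : E, w ≠ wstar → risk D wstar < risk D w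

/-- `lam`, `v` is an eigendecomposition `T = ∑ᵢ lamᵢ vᵢ vᵢᵀ` with the eigenvalues, repeated
according to multiplicity, sorted in non-increasing order, and with finite trace `∑ᵢ lamᵢ`. -/
structure IsSortedEigendecomposition {E : Type*} [NormedAddCommGroup E] [InnerProductSpace ℝ E]
    {d : ℕ∞} (T : E →L[ℝ] E) (lam : Idx d → ℝ) (v : HilbertBasis (Idx d) ℝ E) : Prop where
  apply_eq : ∀ i, T (v i) = lam i • v i
  sorted : Antitone lam
  summable : Summable lam

/-- Fourth moment condition with constant `α`: for every positive semidefinite `A`,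
`E[x xᵀ A x xᵀ] ≼ α tr(H A) H` in the Loewner order. -/
def FourthMomentCondition {E ι : Type*} [NormedAddCommGroup E] [InnerProductSpace ℝ E]
    [MeasurableSpace E] (D : Measure (E × ℝ)) (b : HilbertBasis ι ℝ E) (α : ℝ) : Prop :=
  ∀ A : E →L[ℝ] E, A.IsPositive →
    fourthMoment D A ≤ (α * traceIn b (secondMoment D ∘L A)) • secondMoment D

/-- Noise condition: `Σ` exists, and `H^{-1/2} Σ H^{-1/2}` exists as a bounded operator, with norm
`sigmaSq`. In infinite dimension `H^{-1/2}` is unbounded, so this operator is described as the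
bounded `S` (unique for strictly positive `H`) with `H^{1/2} S H^{1/2} = Σ`; here `R = H^{1/2}` is
the positive square root of `H`. -/
structure NoiseCondition {E : Type*} [NormedAddCommGroup E] [InnerProductSpace ℝ E]
    [MeasurableSpace E] (D : Measure (E × ℝ)) (wstar : E) (sigmaSq : ℝ) : Prop where
  integrable : Integrable (fun z => (z.2 - ⟪wstar, z.1⟫_ℝ) ^ 2 • outer z.1) D
  norm_eq : ∃ R S : E →L[ℝ] E, R.IsPositive ∧ R ∘L R = secondMoment D ∧
    R ∘L S ∘L R = noiseCov D wstar ∧ ‖S‖ = sigmaSq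

end Model

section Algorithm

/-- The SGD iterates `w_t = w_{t-1} + γ (y_t - ⟨w_{t-1}, x_t⟩) x_t` started at `w0`, on the stream
of examples `z t = (x_t, y_t)`, `t ≥ 1` (the entry `z 0` is not used). -/
def iterate {E : Type*} [NormedAddCommGroup E] [InnerProductSpace ℝ E]
    (γ : ℝ) (w0 : E) (z : ℕ → E × ℝ) : ℕ → E
  | 0 => w0
  | t + 1 => iterate γ w0 z t +
      (γ * ((z (t + 1)).2 - ⟪iterate γ w0 z t, (z (t + 1)).1⟫_ℝ)) • (z (t + 1)).1

/-- The average `(1/N) ∑_{t=0}^{N-1} w_t` of the iterates. -/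
def averagedIterate {E : Type*} [NormedAddCommGroup E] [InnerProductSpace ℝ E]
    (γ : ℝ) (w0 : E) (z : ℕ → E × ℝ) (N : ℕ) : E :=
  (1 / (N : ℝ)) • ∑ t ∈ Finset.range N, iterate γ w0 z t

end Algorithm

section Spectrum

/-- `max {k : λ_k ≥ τ}` in one-based numbering, and `0` if there is no such `k`. -/
def effectiveDim {d : ℕ∞} (lam : Idx d → ℝ) (τ : ℝ) : ℕ :=
  sSup {k : ℕ | ∃ i : Idx d, (i : ℕ) + 1 = k ∧ τ ≤ lam i}

/-- `‖w‖²_{H_{0:k}^{-1}} = ∑_{i ≤ k} ⟨vᵢ, w⟩² / λᵢ` in one-based numbering. -/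
def headInvNormSq {E : Type*} [NormedAddCommGroup E] [InnerProductSpace ℝ E] {d : ℕ∞}
    (lam : Idx d → ℝ) (v : HilbertBasis (Idx d) ℝ E) (k : ℕ) (w : E) : ℝ :=
  ∑' i : Idx d, if (i : ℕ) < k then ⟪v i, w⟫_ℝ ^ 2 / lam i else 0

/-- `‖w‖²_{H_{k:∞}} = ∑_{i > k} λᵢ ⟨vᵢ, w⟩²` in one-based numbering. -/
def tailNormSq {E : Type*} [NormedAddCommGroup E] [InnerProductSpace ℝ E] {d : ℕ∞}
    (lam : Idx d → ℝ) (v : HilbertBasis (Idx d) ℝ E) (k : ℕ) (w : E) : ℝ :=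
  ∑' i : Idx d, if (i : ℕ) < k then 0 else lam i * ⟪v i, w⟫_ℝ ^ 2

/-- `∑_{i > k} λᵢ²` in one-based numbering. -/
def tailSqSum {d : ℕ∞} (lam : Idx d → ℝ) (k : ℕ) : ℝ :=
  ∑' i : Idx d, if (i : ℕ) < k then 0 else lam i ^ 2

/-- The effective bias for the stepsize `1 / (2 α ∑ᵢ λᵢ)`; `w` stands for `w₀ - w*` and `k` for the
effective dimension. -/
def effectiveBias {E : Type*} [NormedAddCommGroup E] [InnerProductSpace ℝ E] {d : ℕ∞}
    (α : ℝ) (lam : Idx d → ℝ) (v : HilbertBasis (Idx d) ℝ E) (w : E) (N k : ℕ) : ℝ :=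
  4 * α ^ 2 * (∑' i, lam i) ^ 2 / (N : ℝ) ^ 2 * headInvNormSq lam v k w + tailNormSq lam v k w

/-- The effective variance for the stepsize `1 / (2 α ∑ᵢ λᵢ)`; `w` stands for `w₀ - w*` and `k` for
the effective dimension. -/
def effectiveVar {E : Type*} [NormedAddCommGroup E] {d : ℕ∞}
    (α sigmaSq : ℝ) (lam : Idx d → ℝ) (w : E) (N k : ℕ) : ℝ :=
  (2 * sigmaSq + α ^ 2 * (∑' i, lam i) * ‖w‖ ^ 2 / N) *
    ((k : ℝ) / N + N * tailSqSum lam k / (4 * α ^ 2 * (∑' i, lam i) ^ 2))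

end Spectrum

end

end LinRegSGD

/-! The error `w_t - w*` is a sum of two runs of one recursion: the bias (noiseless, started at `w0
- w*`) and the noise (started at zero, driven by the residual), see `iterate_eq`. The excess risk is
half the quadratic form of `H`, so splitting the averaged error into these two runs costs only the
factor 2 in the conclusion.

Everything then becomes scalar along each eigenvector. Put `u = γ λ_i` and let `q_t(i)` be the
second moment of the `i`-th coordinate of the error. A fresh example contracts the conditional mean
of the coordinate by `1 - u`, so time correlations decay geometrically and the average is controlled
by the sum of `(1 - (1 - u)^(N - s)) q_s(i)` over `s < N` (`integral_inner_avg_sq_le`). The fourth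
moment and noise conditions give a linear recursion for `q_t(i)`, whose coordinates interact only
through the energy `∑_j λ_j q_t(j)` (`integral_inner_errStep_sq_le`). The stepsize is tuned so that
`γ α tr H = 1/2`: for the bias the energies are then summable along the trajectory
(`sum_energy_le`), and for the noise `q_t(i)` stays below `2 γ σ² (1 - (1 - u)^t)`
(`noise_moment_le`).

In both cases the contribution of coordinate `i` carries the factor `(1 - (1 - u)^N)²`, at most `1`
and at most `(N u)²`. Using the first bound on the head and the second on the tail
(`spectral_sum_le`) gives the theorem. The split may be made at any index; the effective dimension
marks where `N γ λ_i` crosses one. The `‖w0 - w*‖²` term of the variance is the multiplicative noise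
of the bias run. -/

namespace LinRegSGD

set_option linter.unusedSectionVars false

/-! ### Scalar recursions for second moments along eigenvectors. -/

section Recursions

/-- Bernoulli's inequality in the form `1 - (1 - u)^n ≤ n u`. -/
lemma one_sub_pow_le_mul {u : ℝ} (hu : u ≤ 1) (n : ℕ) : 1 - (1 - u) ^ n ≤ n * u := by
  have h := one_add_mul_le_pow (a := -u) (by linarith) n
  rw [← sub_eq_add_neg] at h
  linarith

/-- A double sum of geometrically decaying correlations is controlled by its diagonal. -/
lemma sum_sum_geometric_le {u : ℝ} (hu : 0 ≤ u) (q : ℕ → ℝ) (hq : ∀ t, 0 ≤ q t)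
    (c : ℕ → ℕ → ℝ) (hsymm : ∀ s t, c s t = c t s)
    (hc : ∀ s j, c s (s + j) = (1 - u) ^ j * q s) (N : ℕ) :
    u * ∑ s ∈ Finset.range N, ∑ t ∈ Finset.range N, c s t ≤
      2 * ∑ s ∈ Finset.range N, (1 - (1 - u) ^ (N - s)) * q s := by
  induction N with
  | zero => simp
  | succ n ih =>
    have h1 : ∑ s ∈ Finset.range (n + 1), ∑ t ∈ Finset.range (n + 1), c s t =
        ∑ s ∈ Finset.range n, ∑ t ∈ Finset.range n, c s t +
          2 * ∑ s ∈ Finset.range n, c s n + q n := by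
      have hd : c n n = q n := by simpa using hc n 0
      simp only [Finset.sum_range_succ, Finset.sum_add_distrib]
      rw [Finset.sum_congr rfl fun t _ => hsymm n t, hd]
      ring
    -- Lengthening the horizon by one raises the weight of `q s` by `u (1 - u)^(n - s)`, exactly `u`
    -- times the new correlation `c s n`. The inequality loses only on the diagonal, which the right
    -- side counts twice.
    have h2 : ∑ s ∈ Finset.range n, (1 - (1 - u) ^ (n + 1 - s)) * q s =
        ∑ s ∈ Finset.range n, (1 - (1 - u) ^ (n - s)) * q s +
          u * ∑ s ∈ Finset.range n, c s n := by
      rw [Finset.mul_sum, ← Finset.sum_add_distrib]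
      refine Finset.sum_congr rfl fun s hs => ?_
      have hs' : s ≤ n := (Finset.mem_range.1 hs).le
      obtain ⟨j, rfl⟩ := Nat.exists_eq_add_of_le hs'
      rw [hc, show s + j + 1 - s = j + 1 by omega, show s + j - s = j by omega, pow_succ]
      ring
    rw [h1, Finset.sum_range_succ, h2]
    simp only [Nat.add_sub_cancel_left, pow_one]
    nlinarith [mul_nonneg hu (hq n)]

/-- Unrolled weighted sum of a sequence with `q (t + 1) ≤ a² q t + e t`. -/
lemma weighted_sum_le_of_recursion {a : ℝ} (ha0 : 0 ≤ a) (ha1 : a ≤ 1) (N : ℕ) :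
    ∀ q e : ℕ → ℝ, (∀ t, q (t + 1) ≤ a ^ 2 * q t + e t) →
    (1 - a ^ 2) * ∑ t ∈ Finset.range N, (1 - a ^ (N - t)) * q t ≤
      (1 - a ^ N) * (1 - a ^ (N + 1)) * q 0 +
        ∑ t ∈ Finset.range N, (1 - a ^ (N - 1 - t)) * (1 - a ^ (N - t)) * e t := by
  induction N with
  | zero => intro q e _; simp
  | succ n ih =>
    intro q e h
    -- The induction removes the first term and applies the hypothesis to the shifted sequences, so
    -- `q` and `e` must stay general.
    have h1 := ih (fun t => q (t + 1)) (fun t => e (t + 1)) fun t => h (t + 1)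
    rw [Finset.sum_range_succ', Finset.sum_range_succ' _ n]
    simp only [Nat.add_sub_add_right, Nat.sub_zero, Nat.add_sub_cancel]
    have h2 : ∑ t ∈ Finset.range n, (1 - a ^ (n - 1 - t)) * (1 - a ^ (n - t)) * e (t + 1) =
        ∑ t ∈ Finset.range n, (1 - a ^ (n - (t + 1))) * (1 - a ^ (n - t)) * e (t + 1) :=
      Finset.sum_congr rfl fun t _ => by rw [show n - 1 - t = n - (t + 1) by omega]
    rw [h2] at h1
    have hn : 0 ≤ 1 - a ^ n := sub_nonneg.2 (pow_le_one₀ ha0 ha1)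
    have hn1 : 0 ≤ 1 - a ^ (n + 1) := sub_nonneg.2 (pow_le_one₀ ha0 ha1)
    have h3 := mul_le_mul_of_nonneg_left (h 0) (mul_nonneg hn hn1)
    simp only [zero_add] at h3
    -- The products `(1 - a^m)(1 - a^(m+1))` are the solution of the backward recursion for the
    -- coefficient of the initial value.
    have h4 : (1 - a ^ (n + 1)) * (1 - a ^ (n + 1 + 1)) * q 0 =
        (1 - a ^ 2) * ((1 - a ^ (n + 1)) * q 0) +
          (1 - a ^ n) * (1 - a ^ (n + 1)) * (a ^ 2 * q 0) := by ring
    linarith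

/-- Closed form of `weighted_sum_le_of_recursion` for `a = 1 - u` with `u ≤ 1 / 2`. -/
lemma weighted_sum_le_sq {u : ℝ} (hu0 : 0 < u) (hu1 : u ≤ 1 / 2) {N : ℕ} (hN : 0 < N)
    (q e : ℕ → ℝ) (hq : 0 ≤ q 0) (he : ∀ t, 0 ≤ e t)
    (h : ∀ t, q (t + 1) ≤ (1 - u) ^ 2 * q t + e t) :
    u * ∑ t ∈ Finset.range N, (1 - (1 - u) ^ (N - t)) * q t ≤
      (1 - (1 - u) ^ N) ^ 2 * (q 0 + 2 / 3 * ∑ t ∈ Finset.range N, e t) := by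
  have h1 := weighted_sum_le_of_recursion (a := 1 - u) (by linarith) (by linarith) N q e h
  set a := 1 - u with ha
  have ha0 : 0 ≤ a := by linarith
  have ha1 : a ≤ 1 := by linarith
  have hpow : ∀ m, 0 ≤ 1 - a ^ m := fun m => sub_nonneg.2 (pow_le_one₀ ha0 ha1)
  have h2 : ∑ t ∈ Finset.range N, (1 - a ^ (N - 1 - t)) * (1 - a ^ (N - t)) * e t ≤
      (1 - a ^ N) ^ 2 * ∑ t ∈ Finset.range N, e t := by
    rw [Finset.mul_sum]
    refine Finset.sum_le_sum fun t _ => mul_le_mul_of_nonneg_right ?_ (he t)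
    rw [sq]
    have hle : ∀ m, m ≤ N → 1 - a ^ m ≤ 1 - a ^ N := fun m hm =>
      sub_le_sub_left (pow_le_pow_of_le_one ha0 ha1 hm) _
    exact mul_le_mul (hle _ (by omega)) (hle _ (by omega)) (hpow _) (hpow _)
  have haN : a ^ N ≤ a := by
    simpa using pow_le_pow_of_le_one ha0 ha1 (show 1 ≤ N from hN)
  have h3 : (1 - a ^ N) * (1 - a ^ (N + 1)) * q 0 ≤ (1 + a) * ((1 - a ^ N) ^ 2 * q 0) := by
    have : (1 - a ^ (N + 1)) ≤ (1 + a) * (1 - a ^ N) := by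
      rw [pow_succ]; nlinarith
    have := mul_le_mul_of_nonneg_right (mul_le_mul_of_nonneg_left this (hpow N)) hq
    calc _ ≤ _ := this
      _ = _ := by ring
  have h4 : 1 - a ^ 2 = u * (1 + a) := by rw [ha]; ring
  have hE : 0 ≤ (1 - a ^ N) ^ 2 * ∑ t ∈ Finset.range N, e t :=
    mul_nonneg (sq_nonneg _) (Finset.sum_nonneg fun t _ => he t)
  -- The constant `2/3` comes from `1 + a ≥ 3/2`, that is from `u ≤ 1/2`.
  have h5 : (1 - a ^ N) ^ 2 * ∑ t ∈ Finset.range N, e t ≤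
      (1 + a) * (2 / 3 * ((1 - a ^ N) ^ 2 * ∑ t ∈ Finset.range N, e t)) := by
    nlinarith
  rw [h4] at h1
  refine le_of_mul_le_mul_left ?_ (show 0 < 1 + a by linarith)
  nlinarith

variable {ι : Type*} {lam : ι → ℝ} {q : ℕ → ι → ℝ} {γ α : ℝ}

/-- Summability is propagated along the second moment recursion. -/
lemma summable_of_moment_recursion (hlam : ∀ i, 0 ≤ lam i) (hsum : Summable lam)
    (hγ : 0 ≤ γ) {b : ℝ} (hq : ∀ t i, 0 ≤ q t i) (hq0 : Summable (q 0)) (S : ℕ → ℝ)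
    (hrec : ∀ t i, q (t + 1) i ≤ (1 - 2 * (γ * lam i)) * q t i + b * lam i * S t) (t : ℕ) :
    Summable (q t) := by
  induction t with
  | zero => exact hq0
  | succ t ih =>
    refine Summable.of_nonneg_of_le (hq _) (fun i => ?_) (ih.add (hsum.mul_left (b * S t)))
    have := mul_nonneg (mul_nonneg hγ (hlam i)) (hq t i)
    linarith [hrec t i]

/-- Energy estimate for the noiseless second moment recursion. -/
lemma sum_energy_le (hlam : ∀ i, 0 ≤ lam i) (hsum : Summable lam) (hγ : 0 ≤ γ)
    (hγα : γ * α * ∑' i, lam i = 1 / 2)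
    (hq : ∀ t i, 0 ≤ q t i) (hq0 : Summable (q 0))
    (hrec : ∀ t i, q (t + 1) i ≤ (1 - 2 * (γ * lam i)) * q t i
      + γ ^ 2 * α * lam i * ∑' j, lam j * q t j) (N : ℕ) :
    3 / 2 * γ * ∑ t ∈ Finset.range N, ∑' j, lam j * q t j ≤ ∑' i, q 0 i := by
  have hs := summable_of_moment_recursion hlam hsum hγ hq hq0 (fun t => ∑' j, lam j * q t j) hrec
  have hsl : ∀ t, Summable fun i => lam i * q t i := fun t => by
    refine Summable.of_nonneg_of_le (fun i => mul_nonneg (hlam i) (hq t i)) (fun i => ?_)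
      ((hs t).mul_left (∑' i, lam i))
    exact mul_le_mul_of_nonneg_right (hsum.le_tsum i fun j _ => hlam j) (hq t i)
  have hstep : ∀ t, ∑' i, q (t + 1) i + 3 / 2 * γ * ∑' j, lam j * q t j ≤ ∑' i, q t i := by
    intro t
    have h1 : ∑' i, q (t + 1) i ≤ ∑' i, (q t i - 2 * γ * (lam i * q t i)
        + (γ ^ 2 * α * ∑' j, lam j * q t j) * lam i) := by
      refine (hs (t + 1)).tsum_le_tsum (fun i => ?_)
        (((hs t).sub ((hsl t).mul_left _)).add (hsum.mul_left _))
      linarith [hrec t i]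
    rw [((hs t).sub ((hsl t).mul_left _)).tsum_add (hsum.mul_left _),
      (hs t).tsum_sub ((hsl t).mul_left _), tsum_mul_left, tsum_mul_left] at h1
    -- Summed over `i`, the multiplicative noise returns `γ/2` times the energy while the drift
    -- removes `2γ` times it; the net loss is `3γ/2`.
    have h2 : (γ ^ 2 * α * ∑' j, lam j * q t j) * ∑' i, lam i =
        γ * (γ * α * ∑' i, lam i) * ∑' j, lam j * q t j := by ring
    rw [h2, hγα] at h1
    linarith
  have hsumm : ∀ N, ∑' i, q N i + 3 / 2 * γ * ∑ t ∈ Finset.range N, ∑' j, lam j * q t j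
      ≤ ∑' i, q 0 i := by
    intro N
    induction N with
    | zero => simp
    | succ n ih => rw [Finset.sum_range_succ]; linarith [hstep n]
  have : 0 ≤ ∑' i, q N i := tsum_nonneg (hq N)
  linarith [hsumm N]

/-- Growth of the noisy second moment recursion started at zero. -/
lemma noise_moment_le (hlam : ∀ i, 0 ≤ lam i) (hsum : Summable lam) (hγ : 0 ≤ γ) (hα : 0 ≤ α)
    (hγα : γ * α * ∑' i, lam i = 1 / 2) (hu : ∀ i, γ * lam i ≤ 1 / 2) {σ2 : ℝ} (hσ : 0 ≤ σ2)
    (hq : ∀ t i, 0 ≤ q t i) (hq0 : ∀ i, q 0 i = 0)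
    (hrec : ∀ t i, q (t + 1) i ≤ (1 - 2 * (γ * lam i)) * q t i
      + γ ^ 2 * α * lam i * ∑' j, lam j * q t j + γ ^ 2 * σ2 * lam i) (t : ℕ) :
    ∀ i, q t i ≤ 2 * γ * σ2 * (1 - (1 - γ * lam i) ^ t) := by
  induction t with
  | zero => intro i; simp [hq0]
  | succ t ih =>
    intro i
    have hγσ : 0 ≤ γ * σ2 := mul_nonneg hγ hσ
    have hpow : ∀ i, 0 ≤ (1 - γ * lam i) ^ t := fun i => pow_nonneg (by linarith [hu i]) _
    have hS : ∑' j, lam j * q t j ≤ 2 * γ * σ2 * ∑' j, lam j := by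
      rw [← tsum_mul_left]
      have hle : ∀ j, lam j * q t j ≤ 2 * γ * σ2 * lam j := fun j => by
        have : q t j ≤ 2 * γ * σ2 := by nlinarith [ih j, hpow j]
        nlinarith [hlam j]
      exact (Summable.of_nonneg_of_le (fun j => mul_nonneg (hlam j) (hq t j)) hle
        (hsum.mul_left _)).tsum_le_tsum hle (hsum.mul_left _)
    -- Under the inductive bound the multiplicative noise is at most the additive noise, so the
    -- effective noise level is doubled. The claimed bound `B_t` satisfies `B_{t+1} = (1 - u) B_t +
    -- 2 γ σ² u`, which leaves a surplus `u B_t ≥ 0`.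
    have hg : γ ^ 2 * α * lam i * ∑' j, lam j * q t j ≤ γ ^ 2 * σ2 * lam i := by
      have h0 : 0 ≤ γ ^ 2 * α * lam i := mul_nonneg (mul_nonneg (sq_nonneg _) hα) (hlam i)
      calc _ ≤ γ ^ 2 * α * lam i * (2 * γ * σ2 * ∑' j, lam j) := mul_le_mul_of_nonneg_left hS h0
        _ = 2 * (γ * α * ∑' j, lam j) * (γ ^ 2 * σ2 * lam i) := by ring
        _ = _ := by rw [hγα]; ring
    have hui := hu i
    have hli : 0 ≤ γ * lam i := mul_nonneg hγ (hlam i)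
    have h1 : (1 - 2 * (γ * lam i)) * q t i ≤
        (1 - 2 * (γ * lam i)) * (2 * γ * σ2 * (1 - (1 - γ * lam i) ^ t)) :=
      mul_le_mul_of_nonneg_left (ih i) (by linarith)
    have hle1 : (1 - γ * lam i) ^ t ≤ 1 := pow_le_one₀ (by linarith) (by linarith)
    have h2 : 0 ≤ (γ * σ2) * ((γ * lam i) * (1 - (1 - γ * lam i) ^ t)) :=
      mul_nonneg hγσ (mul_nonneg hli (by linarith))
    have h3 := hrec t i
    rw [pow_succ]
    nlinarith

end Recursions

/-! ### Head and tail sums over the eigenbasis. -/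

section SpectralSums

variable {d : ℕ∞}

lemma finite_idx_lt (k : ℕ) : {i : Idx d | (i : ℕ) < k}.Finite :=
  Set.Finite.preimage Subtype.val_injective.injOn (Set.finite_Iio k)

lemma summable_head (f : Idx d → ℝ) (k : ℕ) :
    Summable fun i : Idx d => if (i : ℕ) < k then f i else 0 :=
  summable_of_hasFiniteSupport ((finite_idx_lt k).subset fun i hi => by
    by_contra h
    exact hi (if_neg h))

lemma summable_tail {f : Idx d → ℝ} (hf : ∀ i, 0 ≤ f i) (hs : Summable f) (k : ℕ) :
    Summable fun i : Idx d => if (i : ℕ) < k then 0 else f i :=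
  Summable.of_nonneg_of_le (fun i => by split_ifs <;> simp [hf]) (fun i => by
    split_ifs <;> simp [hf]) hs

lemma tsum_head_one_le (k : ℕ) : ∑' i : Idx d, (if (i : ℕ) < k then (1 : ℝ) else 0) ≤ k := by
  refine Real.tsum_le_of_sum_le (fun i => by split_ifs <;> simp) fun s => ?_
  rw [Finset.sum_boole]
  have : (s.filter fun i : Idx d => (i : ℕ) < k).card ≤ (Finset.range k).card :=
    Finset.card_le_card_of_injOn Subtype.val (fun i hi => by simpa using (Finset.mem_filter.1 hi).2)
      Subtype.val_injective.injOn
  simpa using this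

end SpectralSums

/-! ### Quadratic forms of the moment operators and first-order optimality. -/

section Moments

variable {E : Type*} [NormedAddCommGroup E] [InnerProductSpace ℝ E] [CompleteSpace E]
  [SecondCountableTopology E] [MeasurableSpace E] [BorelSpace E]
  {D : Measure (E × ℝ)} {wstar : E}

/-- The residual `y - ⟨wstar, x⟩` of an example. -/
noncomputable def residual (wstar : E) (z : E × ℝ) : ℝ := z.2 - ⟪wstar, z.1⟫_ℝ

@[fun_prop]
lemma continuous_residual (wstar : E) : Continuous (residual wstar) := by
  unfold residual; fun_prop

lemma continuous_outer : Continuous (outer : E → E →L[ℝ] E) := by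
  have h := (InnerProductSpace.rankOne ℝ (E := E) (F := E)).continuous
  exact h.clm_apply continuous_id

lemma integrable_inner_mul_inner (h : Integrable (fun z : E × ℝ => ‖z.1‖ ^ 2) D) (u w : E) :
    Integrable (fun z => ⟪u, z.1⟫_ℝ * ⟪w, z.1⟫_ℝ) D := by
  refine (h.const_mul (‖u‖ * ‖w‖)).mono' (Continuous.aestronglyMeasurable (by fun_prop))
    (Filter.Eventually.of_forall fun z => ?_)
  rw [norm_mul]
  calc _ ≤ (‖u‖ * ‖z.1‖) * (‖w‖ * ‖z.1‖) :=
        mul_le_mul (norm_inner_le_norm _ _) (norm_inner_le_norm _ _) (norm_nonneg _) (by positivity)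
    _ = _ := by ring

lemma inner_secondMoment (h : Integrable (fun z : E × ℝ => ‖z.1‖ ^ 2) D) (u w : E) :
    ⟪u, secondMoment D w⟫_ℝ = ∫ z, ⟪u, z.1⟫_ℝ * ⟪w, z.1⟫_ℝ ∂D := by
  have hi : Integrable (fun z : E × ℝ => outer z.1) D :=
    h.mono' (continuous_outer.comp continuous_fst).aestronglyMeasurable
      (Filter.Eventually.of_forall fun z => by simp [outer, sq])
  rw [secondMoment, ContinuousLinearMap.integral_apply hi,
    ← integral_inner (hi.apply_continuousLinearMap w)]
  refine integral_congr_ae (Filter.Eventually.of_forall fun z => ?_)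
  simp only [outer, InnerProductSpace.rankOne_apply, inner_smul_right]
  rw [real_inner_comm w, mul_comm]

lemma integrable_sq_mul_sq (h : Integrable (fun z : E × ℝ => ‖z.1‖ ^ 4) D) (u w : E) :
    Integrable (fun z => ⟪w, z.1⟫_ℝ ^ 2 * ⟪u, z.1⟫_ℝ ^ 2) D := by
  refine (h.const_mul (‖w‖ ^ 2 * ‖u‖ ^ 2)).mono' (Continuous.aestronglyMeasurable (by fun_prop))
    (Filter.Eventually.of_forall fun z => ?_)
  rw [norm_mul, norm_pow, norm_pow]
  calc _ ≤ (‖w‖ * ‖z.1‖) ^ 2 * (‖u‖ * ‖z.1‖) ^ 2 := by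
        gcongr <;> exact norm_inner_le_norm _ _
    _ = _ := by ring

lemma inner_fourthMoment_rankOne (h : Integrable (fun z : E × ℝ => ‖z.1‖ ^ 4) D) (u w : E) :
    ⟪u, fourthMoment D (outer w) u⟫_ℝ = ∫ z, ⟪w, z.1⟫_ℝ ^ 2 * ⟪u, z.1⟫_ℝ ^ 2 ∂D := by
  have hc : Continuous fun z : E × ℝ => outer z.1 ∘L outer w ∘L outer z.1 :=
    (continuous_outer.comp continuous_fst).clm_comp
      (continuous_const.clm_comp (continuous_outer.comp continuous_fst))
  have hi : Integrable (fun z : E × ℝ => outer z.1 ∘L outer w ∘L outer z.1) D := by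
    refine (h.const_mul (‖w‖ ^ 2)).mono' hc.aestronglyMeasurable
      (Filter.Eventually.of_forall fun z => ?_)
    calc _ ≤ ‖outer z.1‖ * (‖outer w‖ * ‖outer z.1‖) :=
          (ContinuousLinearMap.opNorm_comp_le _ _).trans
            (mul_le_mul_of_nonneg_left (ContinuousLinearMap.opNorm_comp_le _ _) (norm_nonneg _))
      _ = _ := by simp only [outer, InnerProductSpace.norm_rankOne]; ring
  rw [fourthMoment, ContinuousLinearMap.integral_apply hi,
    ← integral_inner (hi.apply_continuousLinearMap u)]
  refine integral_congr_ae (Filter.Eventually.of_forall fun z => ?_)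
  simp only [outer, ContinuousLinearMap.comp_apply, InnerProductSpace.rankOne_apply,
    inner_smul_right]
  rw [real_inner_comm u, real_inner_comm w]
  ring

lemma secondMoment_symm (h : Integrable (fun z : E × ℝ => ‖z.1‖ ^ 2) D) (u w : E) :
    ⟪u, secondMoment D w⟫_ℝ = ⟪secondMoment D u, w⟫_ℝ := by
  rw [real_inner_comm w, inner_secondMoment h, inner_secondMoment h]
  simp_rw [mul_comm]

/-- The fourth moment condition is needed only for the rank-one operators `A = w wᵀ`, for which
`tr(H A) = ⟨w, H w⟩` by Parseval. -/
lemma integral_sq_mul_sq_le (h4 : Integrable (fun z : E × ℝ => ‖z.1‖ ^ 4) D) {ι : Type*} {v : HilbertBasis ι ℝ E} {α : ℝ}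
    (hα : FourthMomentCondition D v α) (u w : E) :
    ∫ z, ⟪w, z.1⟫_ℝ ^ 2 * ⟪u, z.1⟫_ℝ ^ 2 ∂D ≤
      α * ⟪w, secondMoment D w⟫_ℝ * ⟪u, secondMoment D u⟫_ℝ := by
  have h := hα (outer w) (InnerProductSpace.isPositive_rankOne_self w)
  have ht : traceIn v (secondMoment D ∘L outer w) = ⟪w, secondMoment D w⟫_ℝ := by
    rw [traceIn, ← v.tsum_inner_mul_inner]
    refine tsum_congr fun i => ?_
    simp [outer, inner_smul_right]
  rw [ht] at h
  have h' := (ContinuousLinearMap.le_def _ _).1 h |>.2 u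
  rw [← inner_fourthMoment_rankOne h4]
  simp only [ContinuousLinearMap.reApplyInnerSelf_apply, sub_apply,
    smul_apply, inner_sub_left, inner_smul_left, RCLike.re_to_real] at h'
  rw [real_inner_comm u, real_inner_comm u] at h'
  simpa using h'

lemma memLp_inner (h : Integrable (fun z : E × ℝ => ‖z.1‖ ^ 2) D) (u : E) :
    MemLp (fun z : E × ℝ => ⟪u, z.1⟫_ℝ) 2 D :=
  (memLp_two_iff_integrable_sq (Continuous.aestronglyMeasurable (by fun_prop))).2 (by
    simpa [sq] using integrable_inner_mul_inner h u u)

lemma memLp_residual (hreg : Regularity D wstar) : MemLp (residual wstar) 2 D := by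
  have hy : MemLp (fun z : E × ℝ => z.2) 2 D :=
    (memLp_two_iff_integrable_sq (Continuous.aestronglyMeasurable (by fun_prop))).2
      hreg.integrable_response
  exact hy.sub (memLp_inner hreg.integrable_sq wstar)

lemma integrable_residual_mul_inner (hreg : Regularity D wstar) (u : E) :
    Integrable (fun z : E × ℝ => residual wstar z * ⟪u, z.1⟫_ℝ) D :=
  (memLp_residual hreg).integrable_mul (memLp_inner hreg.integrable_sq u)

lemma risk_add_eq (hreg : Regularity D wstar) (u : E) :
    risk D (wstar + u) = risk D wstar - ∫ z, residual wstar z * ⟪u, z.1⟫_ℝ ∂D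
      + (1 / 2) * ⟪u, secondMoment D u⟫_ℝ := by
  have h0 : Integrable (fun z : E × ℝ => residual wstar z ^ 2) D :=
    (memLp_residual hreg).integrable_sq
  have h1 := integrable_residual_mul_inner hreg u
  have h2 := integrable_inner_mul_inner hreg.integrable_sq u u
  have h3 : ∀ z : E × ℝ, (z.2 - ⟪wstar + u, z.1⟫_ℝ) ^ 2 = residual wstar z ^ 2 -
      2 * (residual wstar z * ⟪u, z.1⟫_ℝ) + ⟪u, z.1⟫_ℝ * ⟪u, z.1⟫_ℝ := fun z => by
    rw [residual, inner_add_left]; ring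
  rw [risk, risk, inner_secondMoment hreg.integrable_sq]
  simp_rw [h3]
  have h4 : Integrable (fun z => residual wstar z ^ 2 - 2 * (residual wstar z * ⟪u, z.1⟫_ℝ)) D :=
    h0.sub (h1.const_mul 2)
  rw [integral_add h4 h2, integral_sub h0 (h1.const_mul 2),
    integral_const_mul]
  simp only [residual]
  ring

/-- First-order optimality of `wstar`. -/
lemma integral_residual_mul_inner (hreg : Regularity D wstar) (u : E) :
    ∫ z, residual wstar z * ⟪u, z.1⟫_ℝ ∂D = 0 := by
  set c := ∫ z, residual wstar z * ⟪u, z.1⟫_ℝ ∂D with hc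
  set b := ⟪u, secondMoment D u⟫_ℝ
  have key : ∀ ε : ℝ, ε * c ≤ (1 / 2) * ε ^ 2 * b := by
    intro ε
    have h := risk_add_eq hreg (ε • u)
    have h1 : risk D wstar ≤ risk D (wstar + ε • u) := by
      by_cases hu : wstar + ε • u = wstar
      · rw [hu]
      · exact (hreg.optimal _ hu).le
    simp only [map_smul, inner_smul_left, inner_smul_right, RCLike.conj_to_real] at h
    have h2 : ∫ z, residual wstar z * (ε * ⟪u, z.1⟫_ℝ) ∂D = ε * c := by
      rw [hc, ← integral_const_mul]
      congr with z; ring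
    rw [h2] at h
    nlinarith
  have hb : 0 ≤ b := by have := key 1; have := key (-1); linarith
  -- Dividing by `b + 1` instead of `b` covers the degenerate case `b = 0`.
  have h1 := key (c / (b + 1))
  have hb1 : 0 < b + 1 := by linarith
  have h2 : c / (b + 1) * c = (b + 1) * (c / (b + 1)) ^ 2 := by field_simp
  rw [h2] at h1
  have h3 : (c / (b + 1)) ^ 2 ≤ 0 := by nlinarith [sq_nonneg (c / (b + 1))]
  have h4 : c / (b + 1) = 0 := by
    have := sq_nonneg (c / (b + 1)); exact pow_eq_zero_iff (two_ne_zero) |>.1 (le_antisymm h3 this)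
  simpa [hb1.ne'] using h4

/-- The excess risk is the quadratic form of the second moment operator. -/
lemma risk_eq (hreg : Regularity D wstar) (w : E) :
    risk D w = risk D wstar + (1 / 2) * ⟪w - wstar, secondMoment D (w - wstar)⟫_ℝ := by
  have h := risk_add_eq hreg (w - wstar)
  rwa [integral_residual_mul_inner hreg, sub_zero, add_sub_cancel] at h

/-- With `R = H^{1/2}` and `Σ = R S R`, the form of `Σ` at `u` is `⟨R u, S R u⟩ ≤ ‖S‖ ‖R u‖²`, and
`‖R u‖² = ⟨u, H u⟩`. Thus `Σ ≼ σ² H` follows without inverting `H`. -/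
lemma integral_residual_sq_mul_sq_le {σ2 : ℝ}
    (hnoise : NoiseCondition D wstar σ2) (u : E) :
    ∫ z, residual wstar z ^ 2 * ⟪u, z.1⟫_ℝ ^ 2 ∂D ≤ σ2 * ⟪u, secondMoment D u⟫_ℝ := by
  obtain ⟨R, S, hR, hRR, hRS, hS⟩ := hnoise.norm_eq
  have hi := hnoise.integrable
  have h1 : ⟪u, noiseCov D wstar u⟫_ℝ = ∫ z, residual wstar z ^ 2 * ⟪u, z.1⟫_ℝ ^ 2 ∂D := by
    rw [noiseCov, ContinuousLinearMap.integral_apply hi,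
      ← integral_inner (hi.apply_continuousLinearMap u)]
    refine integral_congr_ae (Filter.Eventually.of_forall fun z => ?_)
    simp only [outer, smul_apply, InnerProductSpace.rankOne_apply,
      inner_smul_right, residual]
    rw [real_inner_comm u]
    ring
  have hsym : ∀ x y, ⟪R x, y⟫_ℝ = ⟪x, R y⟫_ℝ := fun x y => hR.isSymmetric x y
  rw [← h1, ← hRS, ← hRR, ← hS]
  simp only [ContinuousLinearMap.comp_apply]
  rw [← hsym, ← hsym, real_inner_self_eq_norm_sq]
  calc _ ≤ ‖R u‖ * ‖S (R u)‖ := real_inner_le_norm _ _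
    _ ≤ ‖R u‖ * (‖S‖ * ‖R u‖) := mul_le_mul_of_nonneg_left (S.le_opNorm _) (norm_nonneg _)
    _ = _ := by ring

lemma integrable_residual_sq_mul_norm_sq {σ2 : ℝ} (hnoise : NoiseCondition D wstar σ2) :
    Integrable (fun z => residual wstar z ^ 2 * ‖z.1‖ ^ 2) D := by
  refine hnoise.integrable.norm.congr (Filter.Eventually.of_forall fun z => ?_)
  simp [norm_smul, outer, residual, sq]

variable {ι : Type*} {v : HilbertBasis ι ℝ E} {lam : ι → ℝ}

lemma inner_basis_secondMoment (h : Integrable (fun z : E × ℝ => ‖z.1‖ ^ 2) D)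
    (heig : ∀ i, secondMoment D (v i) = lam i • v i) (i : ι) (w : E) :
    ⟪v i, secondMoment D w⟫_ℝ = lam i * ⟪v i, w⟫_ℝ := by
  rw [secondMoment_symm h, heig, inner_smul_left, RCLike.conj_to_real]

lemma inner_basis_self_secondMoment (h : Integrable (fun z : E × ℝ => ‖z.1‖ ^ 2) D)
    (heig : ∀ i, secondMoment D (v i) = lam i • v i) (i : ι) :
    ⟪v i, secondMoment D (v i)⟫_ℝ = lam i := by
  rw [inner_basis_secondMoment h heig, real_inner_self_eq_norm_sq, v.orthonormal.1 i]; simp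

lemma hasSum_inner_secondMoment (h : Integrable (fun z : E × ℝ => ‖z.1‖ ^ 2) D)
    (heig : ∀ i, secondMoment D (v i) = lam i • v i) (w : E) :
    HasSum (fun i => lam i * ⟪v i, w⟫_ℝ ^ 2) ⟪w, secondMoment D w⟫_ℝ := by
  refine (v.hasSum_inner_mul_inner w (secondMoment D w)).congr_fun fun i => ?_
  rw [inner_basis_secondMoment h heig, real_inner_comm]; ring

lemma eigenvalue_pos (hreg : Regularity D wstar)
    (heig : ∀ i, secondMoment D (v i) = lam i • v i) (i : ι) : 0 < lam i := by
  rw [← inner_basis_self_secondMoment hreg.integrable_sq heig i]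
  exact hreg.posDef _ (v.orthonormal.ne_zero i)

/-- By Jensen's inequality the constant of the fourth moment condition is at least one. -/
lemma one_le_of_fourthMomentCondition [IsProbabilityMeasure D] (hreg : Regularity D wstar)
    (heig : ∀ i, secondMoment D (v i) = lam i • v i) {α : ℝ} (hα : FourthMomentCondition D v α)
    (i : ι) : 1 ≤ α := by
  have hpos := eigenvalue_pos hreg heig i
  have h2 := hreg.integrable_sq
  have h := integral_sq_mul_sq_le hreg.integrable_fourth hα (v i) (v i)
  have hi4 := integrable_sq_mul_sq hreg.integrable_fourth (v i) (v i)
  have hi2 := integrable_inner_mul_inner h2 (v i) (v i)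
  have hm : ∫ z, ⟪v i, z.1⟫_ℝ * ⟪v i, z.1⟫_ℝ ∂D = lam i := by
    rw [← inner_secondMoment h2, inner_basis_self_secondMoment h2 heig]
  rw [inner_basis_self_secondMoment h2 heig] at h
  -- The variance of `⟨v i, x⟩²` is nonnegative, so `λ_i² ≤ E⟨v i, x⟩⁴ ≤ α λ_i²`.
  have h0 : 0 ≤ ∫ z, (⟪v i, z.1⟫_ℝ ^ 2 * ⟪v i, z.1⟫_ℝ ^ 2
      - 2 * lam i * (⟪v i, z.1⟫_ℝ * ⟪v i, z.1⟫_ℝ) + lam i ^ 2) ∂D :=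
    integral_nonneg fun z => by
      have := sq_nonneg (⟪v i, z.1⟫_ℝ ^ 2 - lam i)
      simp only [Pi.zero_apply]; nlinarith
  have hi : Integrable (fun z => ⟪v i, z.1⟫_ℝ ^ 2 * ⟪v i, z.1⟫_ℝ ^ 2
      - 2 * lam i * (⟪v i, z.1⟫_ℝ * ⟪v i, z.1⟫_ℝ)) D := hi4.sub (hi2.const_mul _)
  rw [integral_add hi (integrable_const _),
    integral_sub hi4 (hi2.const_mul _), integral_const_mul, hm] at h0
  simp only [integral_const, probReal_univ, one_smul] at h0
  nlinarith [sq_pos_of_pos hpos]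

end Moments

/-! ### Fubini for a fresh example independent of the past. -/

section Independence

variable {Ω β : Type*} [MeasurableSpace Ω] [MeasurableSpace β] {P : Measure Ω}
  [IsProbabilityMeasure P] {X : Type*} [MeasurableSpace X] {D : Measure X} [IsProbabilityMeasure D]
  {U : Ω → β} {z : Ω → X}

lemma map_prodMk_of_indepFun (hU : Measurable U) (hz : Measurable z) (hlaw : P.map z = D)
    (hind : IndepFun U z P) : P.map (fun ω => (U ω, z ω)) = (P.map U).prod D := by
  rw [(indepFun_iff_map_prod_eq_prod_map_map hU.aemeasurable hz.aemeasurable).1 hind, hlaw]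

lemma integral_indep_eq (hU : Measurable U) (hz : Measurable z) (hlaw : P.map z = D)
    (hind : IndepFun U z P) {f : β → X → ℝ} (hf : Measurable (Function.uncurry f))
    (hi : Integrable (fun ω => f (U ω) (z ω)) P) :
    ∫ ω, f (U ω) (z ω) ∂P = ∫ ω, ∫ x, f (U ω) x ∂D ∂P := by
  have hm := map_prodMk_of_indepFun hU hz hlaw hind
  have hUz : Measurable fun ω => (U ω, z ω) := hU.prodMk hz
  have hi' : Integrable (Function.uncurry f) ((P.map U).prod D) := by
    rw [← hm]; exact (integrable_map_measure hf.aestronglyMeasurable hUz.aemeasurable).2 hi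
  have := Measure.isProbabilityMeasure_map (μ := P) hU.aemeasurable
  calc _ = ∫ p, Function.uncurry f p ∂(P.map fun ω => (U ω, z ω)) :=
        (integral_map hUz.aemeasurable hf.aestronglyMeasurable).symm
    _ = ∫ u, ∫ x, f u x ∂D ∂(P.map U) := by rw [hm, integral_prod _ hi']; rfl
    _ = _ := integral_map hU.aemeasurable
        (hf.stronglyMeasurable.integral_prod_right').aestronglyMeasurable

/-- Averaging over the past first, with the example frozen, is what makes a cross term vanish when
the past error has mean zero. -/
lemma integral_indep_eq_symm (hU : Measurable U) (hz : Measurable z) (hlaw : P.map z = D)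
    (hind : IndepFun U z P) {f : β → X → ℝ} (hf : Measurable (Function.uncurry f))
    (hi : Integrable (fun ω => f (U ω) (z ω)) P) :
    ∫ ω, f (U ω) (z ω) ∂P = ∫ x, ∫ ω, f (U ω) x ∂P ∂D := by
  have hm := map_prodMk_of_indepFun hU hz hlaw hind
  have hUz : Measurable fun ω => (U ω, z ω) := hU.prodMk hz
  have hi' : Integrable (Function.uncurry f) ((P.map U).prod D) := by
    rw [← hm]; exact (integrable_map_measure hf.aestronglyMeasurable hUz.aemeasurable).2 hi
  have := Measure.isProbabilityMeasure_map (μ := P) hU.aemeasurable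
  calc _ = ∫ p, Function.uncurry f p ∂(P.map fun ω => (U ω, z ω)) :=
        (integral_map hUz.aemeasurable hf.aestronglyMeasurable).symm
    _ = ∫ x, ∫ u, f u x ∂(P.map U) ∂D := by rw [hm, integral_prod_symm _ hi']; rfl
    _ = _ := by
      refine integral_congr_ae (Filter.Eventually.of_forall fun x => ?_)
      exact integral_map hU.aemeasurable
        (hf.comp measurable_prodMk_right).aestronglyMeasurable

lemma integrable_mul_of_indepFun (hz : Measurable z) (hlaw : P.map z = D)
    (hind : IndepFun U z P) {g : β → ℝ} {h : X → ℝ} (hg : Measurable g) (hh : Measurable h)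
    (hgi : Integrable (fun ω => g (U ω)) P) (hhi : Integrable h D) :
    Integrable (fun ω => g (U ω) * h (z ω)) P :=
  (hind.comp hg hh).integrable_mul hgi (by
    rw [← hlaw] at hhi
    exact (integrable_map_measure hh.aestronglyMeasurable hz.aemeasurable).1 hhi)

lemma integral_mul_of_indepFun (hU : Measurable U) (hz : Measurable z) (hlaw : P.map z = D)
    (hind : IndepFun U z P) {g : β → ℝ} {h : X → ℝ} (hg : Measurable g) (hh : Measurable h)
    (hgi : Integrable (fun ω => g (U ω)) P) (hhi : Integrable h D) :
    ∫ ω, g (U ω) * h (z ω) ∂P = (∫ ω, g (U ω) ∂P) * ∫ x, h x ∂D := by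
  rw [integral_indep_eq (f := fun u x => g u * h x) hU hz hlaw hind
    ((hg.comp measurable_fst).mul (hh.comp measurable_snd))
    (integrable_mul_of_indepFun hz hlaw hind hg hh hgi hhi)]
  simp_rw [integral_const_mul]
  rw [integral_mul_const]

end Independence

/-! ### One step of the error recursion. -/

section Step

variable {E : Type*} [NormedAddCommGroup E] [InnerProductSpace ℝ E] [CompleteSpace E]
  [SecondCountableTopology E] [MeasurableSpace E] [BorelSpace E]
  {D : Measure (E × ℝ)} [IsProbabilityMeasure D] {wstar : E} {γ c : ℝ}
  {Ω : Type*} [MeasurableSpace Ω] {P : Measure Ω} [IsProbabilityMeasure P]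
  {η : Ω → E} {z : Ω → E × ℝ}

/-- One step of the error recursion, in which the noise enters with the factor `c`. -/
noncomputable def errStep (wstar : E) (γ c : ℝ) (e : E) (z : E × ℝ) : E :=
  e + (γ * (c * residual wstar z - ⟪e, z.1⟫_ℝ)) • z.1

lemma continuous_errStep : Continuous fun p : E × (E × ℝ) => errStep wstar γ c p.1 p.2 := by
  have := continuous_residual wstar
  unfold errStep; fun_prop

lemma inner_errStep (u e : E) (z : E × ℝ) : ⟪u, errStep wstar γ c e z⟫_ℝ =
    ⟪u, e⟫_ℝ + γ * (c * residual wstar z - ⟪e, z.1⟫_ℝ) * ⟪u, z.1⟫_ℝ := by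
  rw [errStep, inner_add_right, inner_smul_right]

lemma integrable_norm_of_sq (hη : Measurable η) (h2 : Integrable (fun ω => ‖η ω‖ ^ 2) P) :
    Integrable (fun ω => ‖η ω‖) P :=
  ((memLp_two_iff_integrable_sq hη.norm.aestronglyMeasurable).2 h2).integrable one_le_two

lemma norm_errStep_sq_le (e : E) (z : E × ℝ) : ‖errStep wstar γ c e z‖ ^ 2 ≤
    3 * ‖e‖ ^ 2 + 3 * (γ * c) ^ 2 * (residual wstar z ^ 2 * ‖z.1‖ ^ 2)
      + 3 * γ ^ 2 * (‖e‖ ^ 2 * ‖z.1‖ ^ 4) := by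
  have h1 : ‖errStep wstar γ c e z‖ ≤
      ‖e‖ + |γ * c| * (|residual wstar z| * ‖z.1‖) + |γ| * (‖e‖ * ‖z.1‖ ^ 2) := by
    have : errStep wstar γ c e z = e + (γ * c * residual wstar z) • z.1
        + (-(γ * ⟪e, z.1⟫_ℝ)) • z.1 := by
      rw [errStep, add_assoc, ← add_smul]; ring_nf
    rw [this]
    refine (norm_add₃_le).trans ?_
    rw [norm_smul, norm_smul, Real.norm_eq_abs, Real.norm_eq_abs, abs_neg, abs_mul (γ * c), abs_mul γ ⟪e, z.1⟫_ℝ]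
    have := mul_le_mul_of_nonneg_left (mul_le_mul_of_nonneg_right
      (abs_real_inner_le_norm e z.1) (norm_nonneg z.1)) (abs_nonneg γ)
    nlinarith
  set A := ‖e‖
  set B := |γ * c| * (|residual wstar z| * ‖z.1‖) with hB
  set C := |γ| * (‖e‖ * ‖z.1‖ ^ 2) with hC
  have hB2 : B ^ 2 = (γ * c) ^ 2 * (residual wstar z ^ 2 * ‖z.1‖ ^ 2) := by
    rw [hB, mul_pow, mul_pow, sq_abs, sq_abs]
  have hC2 : C ^ 2 = γ ^ 2 * (‖e‖ ^ 2 * ‖z.1‖ ^ 4) := by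
    rw [hC, mul_pow, mul_pow, sq_abs]; ring
  calc _ ≤ (A + B + C) ^ 2 := pow_le_pow_left₀ (norm_nonneg _) h1 2
    _ ≤ 3 * A ^ 2 + 3 * B ^ 2 + 3 * C ^ 2 := by
      nlinarith [sq_nonneg (A - B), sq_nonneg (A - C), sq_nonneg (B - C)]
    _ = _ := by rw [hB2, hC2]; ring

lemma integrable_comp_of_law (hz : Measurable z) (hlaw : P.map z = D) {h : E × ℝ → ℝ}
    (hh : Measurable h) (hhi : Integrable h D) : Integrable (fun ω => h (z ω)) P := by
  rw [← hlaw] at hhi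
  exact (integrable_map_measure hh.aestronglyMeasurable hz.aemeasurable).1 hhi

lemma integral_comp_of_law (hz : Measurable z) (hlaw : P.map z = D) {h : E × ℝ → ℝ}
    (hh : Measurable h) : ∫ ω, h (z ω) ∂P = ∫ x, h x ∂D := by
  rw [← hlaw, integral_map hz.aemeasurable hh.aestronglyMeasurable]

lemma integrable_norm_errStep_sq (hreg : Regularity D wstar) {σ2 : ℝ}
    (hnoise : NoiseCondition D wstar σ2) (hη : Measurable η)
    (hη2 : Integrable (fun ω => ‖η ω‖ ^ 2) P) (hz : Measurable z) (hlaw : P.map z = D)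
    (hind : IndepFun η z P) :
    Integrable (fun ω => ‖errStep wstar γ c (η ω) (z ω)‖ ^ 2) P := by
  have h1 : Integrable (fun ω => residual wstar (z ω) ^ 2 * ‖(z ω).1‖ ^ 2) P :=
    integrable_comp_of_law hz hlaw (h := fun z => residual wstar z ^ 2 * ‖z.1‖ ^ 2)
      (Continuous.measurable (by fun_prop)) (integrable_residual_sq_mul_norm_sq hnoise)
  have h2 : Integrable (fun ω => ‖η ω‖ ^ 2 * ‖(z ω).1‖ ^ 4) P :=
    integrable_mul_of_indepFun hz hlaw hind (g := fun e => ‖e‖ ^ 2) (h := fun z => ‖z.1‖ ^ 4)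
      (Continuous.measurable (by fun_prop)) (Continuous.measurable (by fun_prop)) hη2
      hreg.integrable_fourth
  refine (((hη2.const_mul 3).add (h1.const_mul (3 * (γ * c) ^ 2))).add
    (h2.const_mul (3 * γ ^ 2))).mono' ?_ (Filter.Eventually.of_forall fun ω => ?_)
  · exact (((continuous_errStep.measurable.comp (hη.prodMk hz)).norm).pow_const 2).aestronglyMeasurable
  · rw [Real.norm_of_nonneg (by positivity)]
    exact norm_errStep_sq_le _ _

/-- Conditionally on the past, a step contracts the mean by `1 - γ H`. -/
lemma integral_inner_errStep_mul (hreg : Regularity D wstar) (hη : Measurable η)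
    (hη2 : Integrable (fun ω => ‖η ω‖ ^ 2) P) {U : Ω → ℝ} (hU : Measurable U)
    (hU2 : Integrable (fun ω => U ω ^ 2) P) (hz : Measurable z) (hlaw : P.map z = D)
    (hind : IndepFun (fun ω => (η ω, U ω)) z P) (u : E) :
    ∫ ω, ⟪u, errStep wstar γ c (η ω) (z ω)⟫_ℝ * U ω ∂P =
      ∫ ω, ⟪u - γ • secondMoment D u, η ω⟫_ℝ * U ω ∂P := by
  have hV : Measurable fun ω => (η ω, U ω) := hη.prodMk hU
  have hUL : MemLp U 2 P := (memLp_two_iff_integrable_sq hU.aestronglyMeasurable).2 hU2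
  have hηL : MemLp (fun ω => ‖η ω‖) 2 P :=
    (memLp_two_iff_integrable_sq hη.norm.aestronglyMeasurable).2 hη2
  have hηU : Integrable (fun ω => ‖η ω‖ * |U ω|) P := hηL.integrable_mul hUL.abs
  have hint : ∀ w : E, Integrable (fun ω => ⟪w, η ω⟫_ℝ * U ω) P := fun w =>
    (hηU.const_mul ‖w‖).mono' (((measurable_const.inner hη).mul hU).aestronglyMeasurable)
      (Filter.Eventually.of_forall fun ω => by
        rw [norm_mul, ← mul_assoc]
        exact mul_le_mul_of_nonneg_right (norm_inner_le_norm _ _) (norm_nonneg _))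
  have hξ : Integrable (fun ω => U ω * (residual wstar (z ω) * ⟪u, (z ω).1⟫_ℝ)) P :=
    integrable_mul_of_indepFun hz hlaw hind (g := fun p => p.2)
      (h := fun z => residual wstar z * ⟪u, z.1⟫_ℝ) measurable_snd
      (Continuous.measurable (by fun_prop)) (hUL.integrable one_le_two)
      (integrable_residual_mul_inner hreg u)
  -- The noise is uncorrelated with the past by first-order optimality of `wstar`; no independence
  -- of residual and `x` is needed.
  have hξ0 : ∫ ω, U ω * (residual wstar (z ω) * ⟪u, (z ω).1⟫_ℝ) ∂P = 0 := by
    rw [integral_mul_of_indepFun hV hz hlaw hind (g := fun p => p.2)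
      (h := fun z => residual wstar z * ⟪u, z.1⟫_ℝ) measurable_snd
      (Continuous.measurable (by fun_prop)) (hUL.integrable one_le_two)
      (integrable_residual_mul_inner hreg u), integral_residual_mul_inner hreg, mul_zero]
  have hq : Integrable (fun ω => U ω * (⟪u, (z ω).1⟫_ℝ * ⟪η ω, (z ω).1⟫_ℝ)) P := by
    have hd : Integrable (fun ω => (‖η ω‖ * |U ω|) * (‖u‖ * ‖(z ω).1‖ ^ 2)) P :=
      integrable_mul_of_indepFun hz hlaw hind (g := fun p => ‖p.1‖ * |p.2|)
        (h := fun z => ‖u‖ * ‖z.1‖ ^ 2) (Continuous.measurable (by fun_prop))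
        (Continuous.measurable (by fun_prop)) hηU (hreg.integrable_sq.const_mul _)
    refine hd.mono' (hU.mul ((measurable_const.inner hz.fst).mul
      (hη.inner hz.fst))).aestronglyMeasurable (Filter.Eventually.of_forall fun ω => ?_)
    rw [norm_mul, norm_mul]
    calc _ ≤ |U ω| * ((‖u‖ * ‖(z ω).1‖) * (‖η ω‖ * ‖(z ω).1‖)) := by
          rw [Real.norm_eq_abs (U ω)]
          gcongr <;> exact norm_inner_le_norm _ _
      _ = _ := by ring
  have hqI : ∫ ω, U ω * (⟪u, (z ω).1⟫_ℝ * ⟪η ω, (z ω).1⟫_ℝ) ∂P =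
      ∫ ω, ⟪secondMoment D u, η ω⟫_ℝ * U ω ∂P := by
    rw [integral_indep_eq (f := fun p z => p.2 * (⟪u, z.1⟫_ℝ * ⟪p.1, z.1⟫_ℝ)) hV hz hlaw hind
      (Continuous.measurable (by fun_prop)) hq]
    refine integral_congr_ae (Filter.Eventually.of_forall fun ω => ?_)
    simp only
    rw [integral_const_mul, ← inner_secondMoment hreg.integrable_sq,
      secondMoment_symm hreg.integrable_sq, mul_comm]
  have hpt : ∀ ω, ⟪u, errStep wstar γ c (η ω) (z ω)⟫_ℝ * U ω = ⟪u, η ω⟫_ℝ * U ω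
      + γ * c * (U ω * (residual wstar (z ω) * ⟪u, (z ω).1⟫_ℝ))
      - γ * (U ω * (⟪u, (z ω).1⟫_ℝ * ⟪η ω, (z ω).1⟫_ℝ)) := fun ω => by
    rw [inner_errStep]; ring
  have hpt' : ∀ ω, ⟪u - γ • secondMoment D u, η ω⟫_ℝ * U ω = ⟪u, η ω⟫_ℝ * U ω
      - γ * (⟪secondMoment D u, η ω⟫_ℝ * U ω) := fun ω => by
    rw [inner_sub_left, inner_smul_left, RCLike.conj_to_real]; ring
  have hs : Integrable (fun ω => ⟪u, η ω⟫_ℝ * U ω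
      + γ * c * (U ω * (residual wstar (z ω) * ⟪u, (z ω).1⟫_ℝ))) P :=
    (hint u).add (hξ.const_mul _)
  simp_rw [hpt, hpt']
  rw [integral_sub hs (hq.const_mul _), integral_add (hint u) (hξ.const_mul _),
    integral_sub (hint u) ((hint _).const_mul _), integral_const_mul, integral_const_mul,
    integral_const_mul, hξ0, hqI]
  ring

lemma integrable_inner_secondMoment (hη : Measurable η)
    (hη2 : Integrable (fun ω => ‖η ω‖ ^ 2) P) :
    Integrable (fun ω => ⟪η ω, secondMoment D (η ω)⟫_ℝ) P := by
  refine (hη2.const_mul ‖secondMoment D‖).mono'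
    (hη.inner ((secondMoment D).measurable.comp hη)).aestronglyMeasurable
    (Filter.Eventually.of_forall fun ω => ?_)
  calc _ ≤ ‖η ω‖ * ‖secondMoment D (η ω)‖ := norm_inner_le_norm _ _
    _ ≤ ‖η ω‖ * (‖secondMoment D‖ * ‖η ω‖) :=
      mul_le_mul_of_nonneg_left (ContinuousLinearMap.le_opNorm _ _) (norm_nonneg _)
    _ = _ := by ring

lemma integrable_inner_sq (hη : Measurable η) (hη2 : Integrable (fun ω => ‖η ω‖ ^ 2) P) (u : E) :
    Integrable (fun ω => ⟪u, η ω⟫_ℝ ^ 2) P :=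
  (hη2.const_mul (‖u‖ ^ 2)).mono' ((measurable_const.inner hη).pow_const 2).aestronglyMeasurable
    (Filter.Eventually.of_forall fun ω => by
      rw [norm_pow, ← mul_pow]
      exact pow_le_pow_left₀ (norm_nonneg _) (norm_inner_le_norm _ _) 2)

/-- The second moment of a coordinate along an eigenvector after one step. -/
lemma integral_inner_errStep_sq_le (hreg : Regularity D wstar) {σ2 : ℝ}
    (hnoise : NoiseCondition D wstar σ2) {ι : Type*} {v : HilbertBasis ι ℝ E} {lam : ι → ℝ}
    (heig : ∀ i, secondMoment D (v i) = lam i • v i) {α : ℝ} (hα : FourthMomentCondition D v α)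
    (hη : Measurable η) (hη2 : Integrable (fun ω => ‖η ω‖ ^ 2) P)
    (hmean : ∀ u, c * ∫ ω, ⟪u, η ω⟫_ℝ ∂P = 0)
    (hz : Measurable z) (hlaw : P.map z = D) (hind : IndepFun η z P) (i : ι) :
    ∫ ω, ⟪v i, errStep wstar γ c (η ω) (z ω)⟫_ℝ ^ 2 ∂P ≤
      (1 - 2 * (γ * lam i)) * ∫ ω, ⟪v i, η ω⟫_ℝ ^ 2 ∂P
        + γ ^ 2 * α * lam i * ∫ ω, ⟪η ω, secondMoment D (η ω)⟫_ℝ ∂P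
        + γ ^ 2 * (c ^ 2 * σ2) * lam i := by
  have h2 := hreg.integrable_sq
  have h4 := hreg.integrable_fourth
  set u := v i with hu
  have hu2 : ⟪u, secondMoment D u⟫_ℝ = lam i := inner_basis_self_secondMoment h2 heig i
  have hm : ∀ w : E, Measurable fun ω => ⟪w, η ω⟫_ℝ := fun w => measurable_const.inner hη
  have hzu : Measurable fun ω => ⟪u, (z ω).1⟫_ℝ := measurable_const.inner hz.fst
  have hzη : Measurable fun ω => ⟪η ω, (z ω).1⟫_ℝ := hη.inner hz.fst
  have hzr : Measurable fun ω => residual wstar (z ω) :=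
    (continuous_residual wstar).measurable.comp hz
  have hinner : ∀ w, Integrable (fun ω => ⟪w, η ω⟫_ℝ) P := fun w =>
    ((integrable_norm_of_sq hη hη2).const_mul ‖w‖).mono' (hm w).aestronglyMeasurable
      (Filter.Eventually.of_forall fun ω => norm_inner_le_norm _ _)
  have i1 := integrable_inner_sq hη hη2 u
  -- the drift
  have i2 : Integrable (fun ω => ⟪u, η ω⟫_ℝ * (⟪u, (z ω).1⟫_ℝ * ⟪η ω, (z ω).1⟫_ℝ)) P := by
    have hd : Integrable (fun ω => (‖η ω‖ ^ 2) * (‖u‖ ^ 2 * ‖(z ω).1‖ ^ 2)) P :=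
      integrable_mul_of_indepFun hz hlaw hind (g := fun e => ‖e‖ ^ 2)
        (h := fun z => ‖u‖ ^ 2 * ‖z.1‖ ^ 2) (Continuous.measurable (by fun_prop))
        (Continuous.measurable (by fun_prop)) hη2 (h2.const_mul _)
    refine hd.mono' ((hm u).mul (hzu.mul hzη)).aestronglyMeasurable
      (Filter.Eventually.of_forall fun ω => ?_)
    rw [norm_mul, norm_mul]
    calc _ ≤ (‖u‖ * ‖η ω‖) * ((‖u‖ * ‖(z ω).1‖) * (‖η ω‖ * ‖(z ω).1‖)) := by
          gcongr <;> exact norm_inner_le_norm _ _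
      _ = _ := by ring
  have e2 : ∫ ω, ⟪u, η ω⟫_ℝ * (⟪u, (z ω).1⟫_ℝ * ⟪η ω, (z ω).1⟫_ℝ) ∂P =
      lam i * ∫ ω, ⟪u, η ω⟫_ℝ ^ 2 ∂P := by
    rw [integral_indep_eq (f := fun e z => ⟪u, e⟫_ℝ * (⟪u, z.1⟫_ℝ * ⟪e, z.1⟫_ℝ)) hη hz hlaw hind
      (Continuous.measurable (by fun_prop)) i2, ← integral_const_mul]
    refine integral_congr_ae (Filter.Eventually.of_forall fun ω => ?_)
    simp only
    rw [integral_const_mul, ← inner_secondMoment h2, hu, inner_basis_secondMoment h2 heig]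
    ring
  -- the multiplicative noise
  have i3 : Integrable (fun ω => ⟪η ω, (z ω).1⟫_ℝ ^ 2 * ⟪u, (z ω).1⟫_ℝ ^ 2) P := by
    have hd : Integrable (fun ω => (‖η ω‖ ^ 2) * (‖u‖ ^ 2 * ‖(z ω).1‖ ^ 4)) P :=
      integrable_mul_of_indepFun hz hlaw hind (g := fun e => ‖e‖ ^ 2)
        (h := fun z => ‖u‖ ^ 2 * ‖z.1‖ ^ 4) (Continuous.measurable (by fun_prop))
        (Continuous.measurable (by fun_prop)) hη2 (h4.const_mul _)
    refine hd.mono' ((hzη.pow_const 2).mul (hzu.pow_const 2)).aestronglyMeasurable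
      (Filter.Eventually.of_forall fun ω => ?_)
    rw [norm_mul, norm_pow, norm_pow]
    calc _ ≤ (‖η ω‖ * ‖(z ω).1‖) ^ 2 * (‖u‖ * ‖(z ω).1‖) ^ 2 := by
          gcongr <;> exact norm_inner_le_norm _ _
      _ = _ := by ring
  have e3 : ∫ ω, ⟪η ω, (z ω).1⟫_ℝ ^ 2 * ⟪u, (z ω).1⟫_ℝ ^ 2 ∂P ≤
      α * lam i * ∫ ω, ⟪η ω, secondMoment D (η ω)⟫_ℝ ∂P := by
    have hf : Measurable (Function.uncurry fun (e : E) (z : E × ℝ) =>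
        ⟪e, z.1⟫_ℝ ^ 2 * ⟪u, z.1⟫_ℝ ^ 2) := Continuous.measurable (by fun_prop)
    rw [integral_indep_eq (f := fun e z => ⟪e, z.1⟫_ℝ ^ 2 * ⟪u, z.1⟫_ℝ ^ 2) hη hz hlaw hind
      hf i3, ← integral_const_mul]
    refine integral_mono_of_nonneg
      (Filter.Eventually.of_forall fun ω => integral_nonneg fun z => by positivity)
      ((integrable_inner_secondMoment hη hη2).const_mul _) (Filter.Eventually.of_forall fun ω => ?_)
    have := integral_sq_mul_sq_le h4 hα u (η ω)
    rw [hu2] at this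
    simp only
    linarith
  -- the additive noise
  have c4 : Measurable fun z : E × ℝ => residual wstar z ^ 2 * ⟪u, z.1⟫_ℝ ^ 2 :=
    Continuous.measurable (by fun_prop)
  have i4 : Integrable (fun ω => residual wstar (z ω) ^ 2 * ⟪u, (z ω).1⟫_ℝ ^ 2) P := by
    refine integrable_comp_of_law hz hlaw c4 ?_
    refine ((integrable_residual_sq_mul_norm_sq hnoise).const_mul (‖u‖ ^ 2)).mono'
      c4.aestronglyMeasurable (Filter.Eventually.of_forall fun z => ?_)
    rw [norm_mul, norm_pow, norm_pow]
    calc _ ≤ ‖residual wstar z‖ ^ 2 * (‖u‖ * ‖z.1‖) ^ 2 := by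
          gcongr; exact norm_inner_le_norm _ _
      _ = _ := by rw [Real.norm_eq_abs, sq_abs]; ring
  have e4 : ∫ ω, residual wstar (z ω) ^ 2 * ⟪u, (z ω).1⟫_ℝ ^ 2 ∂P ≤ σ2 * lam i := by
    rw [integral_comp_of_law hz hlaw c4, ← hu2]
    exact integral_residual_sq_mul_sq_le hnoise u
  -- the cross terms
  have c5 : Measurable fun z : E × ℝ => residual wstar z * ⟪u, z.1⟫_ℝ :=
    Continuous.measurable (by fun_prop)
  have c5' : Measurable fun e : E => ⟪u, e⟫_ℝ := Continuous.measurable (by fun_prop)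
  have i5 : Integrable (fun ω => ⟪u, η ω⟫_ℝ * (residual wstar (z ω) * ⟪u, (z ω).1⟫_ℝ)) P :=
    integrable_mul_of_indepFun hz hlaw hind c5' c5 (hinner u) (integrable_residual_mul_inner hreg u)
  have e5 : ∫ ω, ⟪u, η ω⟫_ℝ * (residual wstar (z ω) * ⟪u, (z ω).1⟫_ℝ) ∂P = 0 := by
    rw [integral_mul_of_indepFun hη hz hlaw hind c5' c5 (hinner u)
      (integrable_residual_mul_inner hreg u), integral_residual_mul_inner hreg, mul_zero]
  -- Both `|residual| ‖x‖` and `‖x‖²` are square integrable, by the noise condition and the fourth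
  -- moment, so their product is integrable.
  have i6 : Integrable (fun ω =>
      ⟪η ω, (z ω).1⟫_ℝ * (residual wstar (z ω) * ⟪u, (z ω).1⟫_ℝ ^ 2)) P := by
    have hx2 : MemLp (fun z : E × ℝ => ‖z.1‖ ^ 2) 2 D :=
      (memLp_two_iff_integrable_sq (Continuous.aestronglyMeasurable (by fun_prop))).2 (by
        simpa only [← pow_mul] using h4)
    have hrx : MemLp (fun z : E × ℝ => |residual wstar z| * ‖z.1‖) 2 D :=
      (memLp_two_iff_integrable_sq (Continuous.aestronglyMeasurable (by fun_prop))).2 (by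
        simpa only [mul_pow, sq_abs] using integrable_residual_sq_mul_norm_sq hnoise)
    have hd : Integrable (fun ω => ‖η ω‖ *
        (‖u‖ ^ 2 * ((|residual wstar (z ω)| * ‖(z ω).1‖) * ‖(z ω).1‖ ^ 2))) P :=
      integrable_mul_of_indepFun hz hlaw hind (g := fun e => ‖e‖)
        (h := fun z => ‖u‖ ^ 2 * ((|residual wstar z| * ‖z.1‖) * ‖z.1‖ ^ 2))
        (Continuous.measurable (by fun_prop)) (Continuous.measurable (by fun_prop))
        (integrable_norm_of_sq hη hη2) ((hrx.integrable_mul hx2).const_mul _)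
    refine hd.mono' (hzη.mul (hzr.mul (hzu.pow_const 2))).aestronglyMeasurable
      (Filter.Eventually.of_forall fun ω => ?_)
    rw [norm_mul, norm_mul, norm_pow, Real.norm_eq_abs (residual _ _)]
    calc _ ≤ (‖η ω‖ * ‖(z ω).1‖) * (|residual wstar (z ω)| * (‖u‖ * ‖(z ω).1‖) ^ 2) := by
          gcongr <;> exact norm_inner_le_norm _ _
      _ = _ := by ring
  -- Optimality does not remove this third-order term. It vanishes because `η` has mean zero (noise
  -- run) or because `c = 0` (bias run), hence the factor `c` in front.
  have e6 : c * ∫ ω, ⟪η ω, (z ω).1⟫_ℝ * (residual wstar (z ω) * ⟪u, (z ω).1⟫_ℝ ^ 2) ∂P = 0 := by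
    rw [integral_indep_eq_symm (f := fun e z => ⟪e, z.1⟫_ℝ * (residual wstar z * ⟪u, z.1⟫_ℝ ^ 2))
      hη hz hlaw hind (Continuous.measurable (by fun_prop)) i6, ← integral_const_mul]
    refine integral_eq_zero_of_ae (Filter.Eventually.of_forall fun z => ?_)
    simp only
    rw [integral_mul_const, ← mul_assoc]
    simp_rw [real_inner_comm z.1]
    rw [hmean, zero_mul, Pi.zero_apply]
  have hpt : ∀ ω, ⟪u, errStep wstar γ c (η ω) (z ω)⟫_ℝ ^ 2 = ⟪u, η ω⟫_ℝ ^ 2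
      + ((-2 * γ) * (⟪u, η ω⟫_ℝ * (⟪u, (z ω).1⟫_ℝ * ⟪η ω, (z ω).1⟫_ℝ))
      + (γ ^ 2 * (⟪η ω, (z ω).1⟫_ℝ ^ 2 * ⟪u, (z ω).1⟫_ℝ ^ 2)
      + ((γ * c) ^ 2 * (residual wstar (z ω) ^ 2 * ⟪u, (z ω).1⟫_ℝ ^ 2)
      + ((2 * γ * c) * (⟪u, η ω⟫_ℝ * (residual wstar (z ω) * ⟪u, (z ω).1⟫_ℝ))
      + (-2 * γ ^ 2 * c) *
        (⟪η ω, (z ω).1⟫_ℝ * (residual wstar (z ω) * ⟪u, (z ω).1⟫_ℝ ^ 2)))))) := fun ω => by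
    rw [inner_errStep]; ring
  have j5 := (i5.const_mul (2 * γ * c)).add (i6.const_mul (-2 * γ ^ 2 * c))
  have j4 := (i4.const_mul ((γ * c) ^ 2)).add j5
  have j3 := (i3.const_mul (γ ^ 2)).add j4
  have j2 := (i2.const_mul (-2 * γ)).add j3
  have hI : ∫ ω, ⟪u, errStep wstar γ c (η ω) (z ω)⟫_ℝ ^ 2 ∂P = ∫ ω, ⟪u, η ω⟫_ℝ ^ 2 ∂P
      + ((-2 * γ) * ∫ ω, ⟪u, η ω⟫_ℝ * (⟪u, (z ω).1⟫_ℝ * ⟪η ω, (z ω).1⟫_ℝ) ∂P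
      + (γ ^ 2 * ∫ ω, ⟪η ω, (z ω).1⟫_ℝ ^ 2 * ⟪u, (z ω).1⟫_ℝ ^ 2 ∂P
      + ((γ * c) ^ 2 * ∫ ω, residual wstar (z ω) ^ 2 * ⟪u, (z ω).1⟫_ℝ ^ 2 ∂P
      + ((2 * γ * c) * ∫ ω, ⟪u, η ω⟫_ℝ * (residual wstar (z ω) * ⟪u, (z ω).1⟫_ℝ) ∂P
      + (-2 * γ ^ 2 * c) *
        ∫ ω, ⟪η ω, (z ω).1⟫_ℝ * (residual wstar (z ω) * ⟪u, (z ω).1⟫_ℝ ^ 2) ∂P)))) := by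
    simp_rw [hpt]
    refine (integral_add i1 j2).trans ?_
    refine congrArg₂ _ rfl ((integral_add (i2.const_mul _) j3).trans ?_)
    refine congrArg₂ _ (integral_const_mul _ _) ((integral_add (i3.const_mul _) j4).trans ?_)
    refine congrArg₂ _ (integral_const_mul _ _) ((integral_add (i4.const_mul _) j5).trans ?_)
    refine congrArg₂ _ (integral_const_mul _ _) ((integral_add (i5.const_mul _)
      (i6.const_mul _)).trans ?_)
    exact congrArg₂ _ (integral_const_mul _ _) (integral_const_mul _ _)
  rw [hI, e2, e5]
  have t3 := mul_le_mul_of_nonneg_left e3 (sq_nonneg γ)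
  have t4 := mul_le_mul_of_nonneg_left e4 (sq_nonneg (γ * c))
  have t6 : (-2 * γ ^ 2 * c) *
      ∫ ω, ⟪η ω, (z ω).1⟫_ℝ * (residual wstar (z ω) * ⟪u, (z ω).1⟫_ℝ ^ 2) ∂P = 0 := by
    rw [mul_assoc, e6, mul_zero]
  rw [t6]
  linarith

/-- The expected quadratic form of `H` computed in an eigenbasis. -/
lemma hasSum_integral_inner_sq (hreg : Regularity D wstar) {ι : Type*} [Countable ι]
    {v : HilbertBasis ι ℝ E} {lam : ι → ℝ} (heig : ∀ i, secondMoment D (v i) = lam i • v i)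
    (hsum : Summable lam) (hη : Measurable η) (hη2 : Integrable (fun ω => ‖η ω‖ ^ 2) P) :
    HasSum (fun i => lam i * ∫ ω, ⟪v i, η ω⟫_ℝ ^ 2 ∂P)
      (∫ ω, ⟪η ω, secondMoment D (η ω)⟫_ℝ ∂P) := by
  have hpos := fun i => (eigenvalue_pos hreg heig i).le
  have hi : ∀ i, Integrable (fun ω => lam i * ⟪v i, η ω⟫_ℝ ^ 2) P := fun i =>
    (integrable_inner_sq hη hη2 (v i)).const_mul _
  have hs : Summable fun i => ∫ ω, ‖lam i * ⟪v i, η ω⟫_ℝ ^ 2‖ ∂P := by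
    refine Summable.of_nonneg_of_le (fun i => integral_nonneg fun ω => norm_nonneg _) (fun i => ?_)
      (hsum.mul_right (∫ ω, ‖η ω‖ ^ 2 ∂P))
    rw [← integral_const_mul]
    refine integral_mono (hi i).norm (hη2.const_mul _) fun ω => ?_
    simp only
    rw [norm_mul, norm_pow, Real.norm_of_nonneg (hpos i)]
    refine mul_le_mul_of_nonneg_left (pow_le_pow_left₀ (norm_nonneg _) ?_ 2) (hpos i)
    simpa [v.orthonormal.1 i] using norm_inner_le_norm (𝕜 := ℝ) (v i) (η ω)
  have h := hasSum_integral_of_summable_integral_norm hi hs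
  simp_rw [fun ω => (hasSum_inner_secondMoment hreg.integrable_sq heig (η ω)).tsum_eq,
    integral_const_mul] at h
  exact h

end Step

/-! ### Bias and noise trajectories and their averages. -/

section ErrorRecursion

variable {E : Type*} [NormedAddCommGroup E] [InnerProductSpace ℝ E] [CompleteSpace E]
  [SecondCountableTopology E] [MeasurableSpace E] [BorelSpace E]
  {D : Measure (E × ℝ)} [IsProbabilityMeasure D] {wstar : E} {γ c : ℝ} {e₀ : E}
  {Ω : Type*} [MeasurableSpace Ω] {P : Measure Ω} [IsProbabilityMeasure P]
  {Z : ℕ → Ω → E × ℝ}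

/-- The error recursion with noise factor `c` started at `e₀`. -/
noncomputable def errIterate (wstar : E) (γ c : ℝ) (e₀ : E) (z : ℕ → E × ℝ) : ℕ → E
  | 0 => e₀
  | t + 1 => errStep wstar γ c (errIterate wstar γ c e₀ z t) (z (t + 1))

/-- The bias-variance decomposition of the iterates. -/
lemma iterate_eq (wstar : E) (γ : ℝ) (w0 : E) (z : ℕ → E × ℝ) (t : ℕ) :
    iterate γ w0 z t =
      wstar + (errIterate wstar γ 0 (w0 - wstar) z t + errIterate wstar γ 1 0 z t) := by
  induction t with
  | zero => simp [iterate, errIterate]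
  | succ t ih =>
    rw [iterate, errIterate, errIterate, ih]
    set b := errIterate wstar γ 0 (w0 - wstar) z t
    set n := errIterate wstar γ 1 0 z t
    have : γ * ((z (t + 1)).2 - ⟪wstar + (b + n), (z (t + 1)).1⟫_ℝ) =
        γ * (0 * residual wstar (z (t + 1)) - ⟪b, (z (t + 1)).1⟫_ℝ)
          + γ * (1 * residual wstar (z (t + 1)) - ⟪n, (z (t + 1)).1⟫_ℝ) := by
      rw [residual, inner_add_left, inner_add_left]; ring
    rw [this, errStep, errStep, add_smul]
    abel

lemma averagedIterate_sub (wstar : E) (γ : ℝ) (w0 : E) (z : ℕ → E × ℝ) {N : ℕ} (hN : 0 < N) :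
    averagedIterate γ w0 z N - wstar =
      (1 / (N : ℝ)) • ∑ t ∈ Finset.range N, errIterate wstar γ 0 (w0 - wstar) z t
        + (1 / (N : ℝ)) • ∑ t ∈ Finset.range N, errIterate wstar γ 1 0 z t := by
  have hN' : (N : ℝ) ≠ 0 := by positivity
  rw [averagedIterate, Finset.sum_congr rfl fun t _ => iterate_eq wstar γ w0 z t,
    Finset.sum_add_distrib, Finset.sum_add_distrib, Finset.sum_const, Finset.card_range,
    smul_add, smul_add, ← Nat.cast_smul_eq_nsmul ℝ, smul_smul, one_div, inv_mul_cancel₀ hN',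
    one_smul]
  abel

/-- The filtration generated by the examples. -/
noncomputable abbrev sampleFiltration (hZ : ∀ t, Measurable (Z t)) :
    Filtration ℕ ‹MeasurableSpace Ω› :=
  Filtration.natural Z fun t => (hZ t).stronglyMeasurable

lemma measurable_errIterate_natural (hZ : ∀ t, Measurable (Z t)) (t : ℕ) :
    Measurable[sampleFiltration hZ t]
      (fun ω => errIterate wstar γ c e₀ (fun t => Z t ω) t) := by
  induction t with
  | zero => exact measurable_const
  | succ t ih =>
    have h1 := ih.mono ((sampleFiltration hZ).mono
      (Nat.le_succ t)) le_rfl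
    have h2 : Measurable[sampleFiltration hZ (t + 1)]
        (Z (t + 1)) :=
      (Filtration.stronglyAdapted_natural (fun t => (hZ t).stronglyMeasurable) (t + 1)).measurable
    exact continuous_errStep.measurable.comp (h1.prodMk h2)

lemma measurable_errIterate (hZ : ∀ t, Measurable (Z t)) (t : ℕ) :
    Measurable (fun ω => errIterate wstar γ c e₀ (fun t => Z t ω) t) :=
  (measurable_errIterate_natural hZ t).mono (Filtration.le _ _) le_rfl

/-- Stated for any variable known at time `t`, so that it also covers pairs of errors at two times,
as the correlation estimate requires. -/
lemma indepFun_of_measurable_natural (hZ : ∀ t, Measurable (Z t)) (hind : iIndepFun Z P)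
    {β : Type*} [MeasurableSpace β] {U : Ω → β} {t : ℕ}
    (hU : Measurable[sampleFiltration hZ t] U) :
    IndepFun U (Z (t + 1)) P := by
  rw [IndepFun_iff_Indep]
  exact indep_of_indep_of_le_left (hind.indep_comap_natural_of_lt
    (fun t => (hZ t).stronglyMeasurable) (Nat.lt_succ_self t)).symm hU.comap_le

lemma integrable_norm_errIterate_sq (hreg : Regularity D wstar) {σ2 : ℝ}
    (hnoise : NoiseCondition D wstar σ2) (hZ : ∀ t, Measurable (Z t))
    (hlaw : ∀ t, P.map (Z t) = D) (hind : iIndepFun Z P) (t : ℕ) :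
    Integrable (fun ω => ‖errIterate wstar γ c e₀ (fun t => Z t ω) t‖ ^ 2) P := by
  induction t with
  | zero => exact integrable_const (‖e₀‖ ^ 2)
  | succ t ih =>
    exact integrable_norm_errStep_sq hreg hnoise (measurable_errIterate hZ t) ih (hZ _) (hlaw _)
      (indepFun_of_measurable_natural hZ hind (measurable_errIterate_natural hZ t))

/-- The noise part of the error has mean zero. -/
lemma integral_inner_errIterate_eq_zero (hreg : Regularity D wstar) {σ2 : ℝ}
    (hnoise : NoiseCondition D wstar σ2) (hZ : ∀ t, Measurable (Z t))
    (hlaw : ∀ t, P.map (Z t) = D) (hind : iIndepFun Z P) (t : ℕ) :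
    ∀ u, ∫ ω, ⟪u, errIterate wstar γ c 0 (fun t => Z t ω) t⟫_ℝ ∂P = 0 := by
  induction t with
  | zero => simp [errIterate]
  | succ t ih =>
    intro u
    have hm := measurable_errIterate_natural (wstar := wstar) (γ := γ) (c := c) (e₀ := 0) hZ t
    have h := integral_inner_errStep_mul (γ := γ) (c := c) (U := fun _ => 1) hreg
      (measurable_errIterate (c := c) (e₀ := 0) hZ t)
      (integrable_norm_errIterate_sq hreg hnoise hZ hlaw hind t) measurable_const
      (integrable_const _) (hZ (t + 1)) (hlaw _)
      (indepFun_of_measurable_natural hZ hind (hm.prodMk measurable_const)) u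
    simp only [mul_one] at h
    exact h.trans (ih _)

variable {ι : Type*} {v : HilbertBasis ι ℝ E} {lam : ι → ℝ}

/-- Correlations of the error coordinates decay geometrically. -/
lemma integral_inner_errIterate_mul (hreg : Regularity D wstar) {σ2 : ℝ}
    (hnoise : NoiseCondition D wstar σ2) (heig : ∀ i, secondMoment D (v i) = lam i • v i)
    (hZ : ∀ t, Measurable (Z t)) (hlaw : ∀ t, P.map (Z t) = D) (hind : iIndepFun Z P)
    (i : ι) (s j : ℕ) :
    ∫ ω, ⟪v i, errIterate wstar γ c e₀ (fun t => Z t ω) s⟫_ℝ *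
        ⟪v i, errIterate wstar γ c e₀ (fun t => Z t ω) (s + j)⟫_ℝ ∂P =
      (1 - γ * lam i) ^ j * ∫ ω, ⟪v i, errIterate wstar γ c e₀ (fun t => Z t ω) s⟫_ℝ ^ 2 ∂P := by
  induction j with
  | zero => simp [sq]
  | succ j ih =>
    have hm := measurable_errIterate_natural (wstar := wstar) (γ := γ) (c := c) (e₀ := e₀) hZ
    have hms := ((hm s).mono ((sampleFiltration hZ).mono
      (Nat.le_add_right s j)) le_rfl)
    have hinner : Measurable fun e : E => ⟪v i, e⟫_ℝ := Continuous.measurable (by fun_prop)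
    -- The earlier coordinate at time `s` plays the role of the past weight `U`.
    have h := integral_inner_errStep_mul (γ := γ) (c := c)
      (U := fun ω => ⟪v i, errIterate wstar γ c e₀ (fun t => Z t ω) s⟫_ℝ) hreg
      (measurable_errIterate (c := c) (e₀ := e₀) hZ (s + j))
      (integrable_norm_errIterate_sq hreg hnoise hZ hlaw hind _)
      (hinner.comp (measurable_errIterate hZ s))
      (integrable_inner_sq (measurable_errIterate hZ s)
        (integrable_norm_errIterate_sq hreg hnoise hZ hlaw hind s) _) (hZ (s + j + 1)) (hlaw _)
      (indepFun_of_measurable_natural hZ hind ((hm (s + j)).prodMk (hinner.comp hms))) (v i)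
    rw [heig, smul_smul] at h
    simp_rw [inner_sub_left, inner_smul_left, RCLike.conj_to_real] at h
    calc _ = _ := by
          refine integral_congr_ae (Filter.Eventually.of_forall fun ω => ?_)
          exact mul_comm _ _
      _ = _ := h
      _ = (1 - γ * lam i) * ∫ ω, ⟪v i, errIterate wstar γ c e₀ (fun t => Z t ω) s⟫_ℝ *
            ⟪v i, errIterate wstar γ c e₀ (fun t => Z t ω) (s + j)⟫_ℝ ∂P := by
          rw [← integral_const_mul]
          refine integral_congr_ae (Filter.Eventually.of_forall fun ω => ?_)
          simp only; ring
      _ = _ := by rw [ih]; ring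

lemma integrable_norm_avg_sq (hreg : Regularity D wstar) {σ2 : ℝ}
    (hnoise : NoiseCondition D wstar σ2) (hZ : ∀ t, Measurable (Z t))
    (hlaw : ∀ t, P.map (Z t) = D) (hind : iIndepFun Z P) (N : ℕ) :
    Integrable (fun ω => ‖(1 / (N : ℝ)) •
      ∑ t ∈ Finset.range N, errIterate wstar γ c e₀ (fun t => Z t ω) t‖ ^ 2) P := by
  have h : MemLp (fun ω => (1 / (N : ℝ)) •
      ∑ t ∈ Finset.range N, errIterate wstar γ c e₀ (fun t => Z t ω) t) 2 P :=
    (memLp_finsetSum (Finset.range N) fun t _ =>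
      (memLp_two_iff_integrable_sq_norm (measurable_errIterate hZ t).aestronglyMeasurable).2
        (integrable_norm_errIterate_sq hreg hnoise hZ hlaw hind t)).const_smul _
  exact (memLp_two_iff_integrable_sq_norm h.1).1 h

/-- The second moment of a coordinate of the averaged error, in terms of the second moments along
the trajectory. -/
lemma integral_inner_avg_sq_le (hreg : Regularity D wstar) {σ2 : ℝ}
    (hnoise : NoiseCondition D wstar σ2) (heig : ∀ i, secondMoment D (v i) = lam i • v i)
    (hZ : ∀ t, Measurable (Z t)) (hlaw : ∀ t, P.map (Z t) = D) (hind : iIndepFun Z P)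
    (hγ : 0 ≤ γ) (N : ℕ) (i : ι) :
    γ * lam i * ∫ ω, ⟪v i, (1 / (N : ℝ)) •
        ∑ t ∈ Finset.range N, errIterate wstar γ c e₀ (fun t => Z t ω) t⟫_ℝ ^ 2 ∂P ≤
      2 / (N : ℝ) ^ 2 * ∑ s ∈ Finset.range N, (1 - (1 - γ * lam i) ^ (N - s)) *
        ∫ ω, ⟪v i, errIterate wstar γ c e₀ (fun t => Z t ω) s⟫_ℝ ^ 2 ∂P := by
  set η : ℕ → Ω → ℝ := fun t ω => ⟪v i, errIterate wstar γ c e₀ (fun t => Z t ω) t⟫_ℝ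
  have hL : ∀ t, MemLp (η t) 2 P := fun t =>
    (memLp_two_iff_integrable_sq
      (measurable_const.inner (measurable_errIterate hZ t)).aestronglyMeasurable).2
      (integrable_inner_sq (measurable_errIterate hZ t)
        (integrable_norm_errIterate_sq hreg hnoise hZ hlaw hind t) _)
  have h := sum_sum_geometric_le (u := γ * lam i)
    (mul_nonneg hγ (eigenvalue_pos hreg heig i).le) (fun t => ∫ ω, η t ω ^ 2 ∂P)
    (fun t => integral_nonneg fun ω => sq_nonneg _) (fun s t => ∫ ω, η s ω * η t ω ∂P)
    (fun s t => by simp_rw [mul_comm])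
    (integral_inner_errIterate_mul hreg hnoise heig hZ hlaw hind i) N
  have hI : ∫ ω, ⟪v i, (1 / (N : ℝ)) •
        ∑ t ∈ Finset.range N, errIterate wstar γ c e₀ (fun t => Z t ω) t⟫_ℝ ^ 2 ∂P =
      1 / (N : ℝ) ^ 2 * ∑ s ∈ Finset.range N, ∑ t ∈ Finset.range N, ∫ ω, η s ω * η t ω ∂P := by
    have hpt : ∀ ω, ⟪v i, (1 / (N : ℝ)) •
        ∑ t ∈ Finset.range N, errIterate wstar γ c e₀ (fun t => Z t ω) t⟫_ℝ ^ 2 =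
        1 / (N : ℝ) ^ 2 * ∑ s ∈ Finset.range N, ∑ t ∈ Finset.range N, η s ω * η t ω := fun ω => by
      rw [inner_smul_right, inner_sum, mul_pow, sq (∑ t ∈ _, _), Finset.sum_mul_sum]
      ring
    simp_rw [hpt]
    have hi : ∀ s t, Integrable (fun ω => η s ω * η t ω) P := fun s t =>
      (hL s).integrable_mul (hL t)
    rw [integral_const_mul, integral_finsetSum _ fun s _ => integrable_finsetSum _ fun t _ => hi s t]
    congr 1
    refine Finset.sum_congr rfl fun s _ => ?_
    exact integral_finsetSum _ fun t _ => hi s t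
  rw [hI]
  have hN : (0 : ℝ) ≤ 1 / (N : ℝ) ^ 2 := by positivity
  calc _ = 1 / (N : ℝ) ^ 2 * (γ * lam i *
        ∑ s ∈ Finset.range N, ∑ t ∈ Finset.range N, ∫ ω, η s ω * η t ω ∂P) := by ring
    _ ≤ _ := mul_le_mul_of_nonneg_left h hN
    _ = _ := by ring

/-- Recursion of the second moments of the coordinates of the error. -/
lemma integral_inner_errIterate_sq_succ_le (hreg : Regularity D wstar) {σ2 : ℝ}
    (hnoise : NoiseCondition D wstar σ2) [Countable ι]
    (heig : ∀ i, secondMoment D (v i) = lam i • v i) (hsum : Summable lam)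
    {α : ℝ} (hα : FourthMomentCondition D v α)
    (hZ : ∀ t, Measurable (Z t)) (hlaw : ∀ t, P.map (Z t) = D) (hind : iIndepFun Z P)
    (hc : c = 0 ∨ e₀ = 0) (t : ℕ) (i : ι) :
    ∫ ω, ⟪v i, errIterate wstar γ c e₀ (fun t => Z t ω) (t + 1)⟫_ℝ ^ 2 ∂P ≤
      (1 - 2 * (γ * lam i)) * ∫ ω, ⟪v i, errIterate wstar γ c e₀ (fun t => Z t ω) t⟫_ℝ ^ 2 ∂P
        + γ ^ 2 * α * lam i *
          ∑' j, lam j * ∫ ω, ⟪v j, errIterate wstar γ c e₀ (fun t => Z t ω) t⟫_ℝ ^ 2 ∂P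
        + γ ^ 2 * (c ^ 2 * σ2) * lam i := by
  have hm := measurable_errIterate (wstar := wstar) (γ := γ) (c := c) (e₀ := e₀) hZ t
  have h2 := integrable_norm_errIterate_sq (γ := γ) (c := c) (e₀ := e₀) hreg hnoise hZ hlaw hind t
  rw [(hasSum_integral_inner_sq hreg heig hsum hm h2).tsum_eq]
  refine integral_inner_errStep_sq_le hreg hnoise heig hα hm h2 (fun u => ?_) (hZ _) (hlaw _)
    (indepFun_of_measurable_natural hZ hind (measurable_errIterate_natural hZ t)) i
  rcases hc with rfl | rfl
  · exact zero_mul _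
  · rw [integral_inner_errIterate_eq_zero hreg hnoise hZ hlaw hind, mul_zero]

/-- Bound on a coordinate of the averaged bias. -/
lemma bias_coordinate_le (hreg : Regularity D wstar) {σ2 : ℝ}
    (hnoise : NoiseCondition D wstar σ2) [Countable ι]
    (heig : ∀ i, secondMoment D (v i) = lam i • v i) (hsum : Summable lam)
    {α : ℝ} (hα0 : 0 ≤ α) (hα : FourthMomentCondition D v α)
    (hZ : ∀ t, Measurable (Z t)) (hlaw : ∀ t, P.map (Z t) = D) (hind : iIndepFun Z P)
    (hγ : 0 < γ) (hγα : γ * α * ∑' i, lam i = 1 / 2) (hu : ∀ i, γ * lam i ≤ 1 / 2)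
    {N : ℕ} (hN : 0 < N) (i : ι) :
    1 / 2 * (lam i * ∫ ω, ⟪v i, (1 / (N : ℝ)) •
        ∑ t ∈ Finset.range N, errIterate wstar γ 0 e₀ (fun t => Z t ω) t⟫_ℝ ^ 2 ∂P) ≤
      (1 - (1 - γ * lam i) ^ N) ^ 2 * (⟪v i, e₀⟫_ℝ ^ 2 / lam i / (γ * N) ^ 2
        + α * ‖e₀‖ ^ 2 / (2 * γ * N ^ 2)) := by
  have hpos := eigenvalue_pos hreg heig
  set q : ℕ → ι → ℝ := fun t i =>
    ∫ ω, ⟪v i, errIterate wstar γ 0 e₀ (fun t => Z t ω) t⟫_ℝ ^ 2 ∂P with hqdef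
  have hq : ∀ t i, 0 ≤ q t i := fun t i => integral_nonneg fun ω => sq_nonneg _
  have hq0 : q 0 = fun i => ⟪v i, e₀⟫_ℝ ^ 2 := by
    funext i; simp [hqdef, errIterate]
  have hb : HasSum (q 0) (‖e₀‖ ^ 2) := by
    rw [hq0, ← real_inner_self_eq_norm_sq]
    refine (v.hasSum_inner_mul_inner e₀ e₀).congr_fun fun i => ?_
    rw [real_inner_comm, sq]
  have hrec : ∀ t i, q (t + 1) i ≤ (1 - 2 * (γ * lam i)) * q t i
      + γ ^ 2 * α * lam i * ∑' j, lam j * q t j := fun t i => by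
    simpa using integral_inner_errIterate_sq_succ_le (c := 0) (γ := γ) (e₀ := e₀) hreg hnoise heig
      hsum hα hZ hlaw hind (Or.inl rfl) t i
  have hen := sum_energy_le (fun i => (hpos i).le) hsum hγ.le hγα hq hb.summable hrec N
  rw [hb.tsum_eq] at hen
  set S : ℕ → ℝ := fun t => ∑' j, lam j * q t j
  have hS0 : ∀ t, 0 ≤ S t := fun t => tsum_nonneg fun j => mul_nonneg (hpos j).le (hq t j)
  -- The factor `1 - 2u` is relaxed to `(1 - u)²`, and the energies are treated as a forcing term.
  have hw := weighted_sum_le_sq (mul_pos hγ (hpos i)) (hu i) hN (fun t => q t i)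
    (fun t => γ ^ 2 * α * lam i * S t) (hq 0 i)
    (fun t => mul_nonneg (mul_nonneg (mul_nonneg (sq_nonneg _) hα0) (hpos i).le) (hS0 t))
    (fun t => (hrec t i).trans (by
      have := mul_nonneg (sq_nonneg (γ * lam i)) (hq t i)
      nlinarith))
  rw [← Finset.mul_sum] at hw
  have havg := integral_inner_avg_sq_le (c := 0) (e₀ := e₀) hreg hnoise heig hZ hlaw hind hγ.le N i
  set A := ∫ ω, ⟪v i, (1 / (N : ℝ)) •
        ∑ t ∈ Finset.range N, errIterate wstar γ 0 e₀ (fun t => Z t ω) t⟫_ℝ ^ 2 ∂P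
  set W := ∑ s ∈ Finset.range N, (1 - (1 - γ * lam i) ^ (N - s)) * q s i
  set G := (1 - (1 - γ * lam i) ^ N) ^ 2
  have hG0 : 0 ≤ G := sq_nonneg _
  have hl := hpos i
  have hN' : (0 : ℝ) < N := by exact_mod_cast hN
  -- The two factors `2/3`, from the weighted sum and from the energy estimate, give `4/9`, rounded
  -- up to `1/2`.
  have h1 : γ * lam i * W ≤ G * (⟪v i, e₀⟫_ℝ ^ 2 + γ * lam i * (α / 2 * ‖e₀‖ ^ 2)) := by
    refine hw.trans (mul_le_mul_of_nonneg_left ?_ hG0)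
    have h2 : q 0 i = ⟪v i, e₀⟫_ℝ ^ 2 := congrFun hq0 i
    have h3 : 0 ≤ γ * lam i * α := by positivity
    have h4 := mul_le_mul_of_nonneg_left hen h3
    have h5 : 0 ≤ γ * lam i * α * ‖e₀‖ ^ 2 := by positivity
    simp only [h2]
    nlinarith
  calc 1 / 2 * (lam i * A) = 1 / (2 * γ) * (γ * lam i * A) := by field_simp
    _ ≤ 1 / (2 * γ) * (2 / (N : ℝ) ^ 2 * W) := mul_le_mul_of_nonneg_left havg (by positivity)
    _ = 1 / (γ ^ 2 * lam i * N ^ 2) * (γ * lam i * W) := by field_simp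
    _ ≤ 1 / (γ ^ 2 * lam i * N ^ 2) *
        (G * (⟪v i, e₀⟫_ℝ ^ 2 + γ * lam i * (α / 2 * ‖e₀‖ ^ 2))) :=
      mul_le_mul_of_nonneg_left h1 (by positivity)
    _ = _ := by field_simp

/-- Bound on a coordinate of the averaged noise. -/
lemma noise_coordinate_le (hreg : Regularity D wstar) {σ2 : ℝ} (hσ : 0 ≤ σ2)
    (hnoise : NoiseCondition D wstar σ2) [Countable ι]
    (heig : ∀ i, secondMoment D (v i) = lam i • v i) (hsum : Summable lam)
    {α : ℝ} (hα0 : 0 ≤ α) (hα : FourthMomentCondition D v α)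
    (hZ : ∀ t, Measurable (Z t)) (hlaw : ∀ t, P.map (Z t) = D) (hind : iIndepFun Z P)
    (hγ : 0 < γ) (hγα : γ * α * ∑' i, lam i = 1 / 2) (hu : ∀ i, γ * lam i ≤ 1 / 2)
    {N : ℕ} (hN : 0 < N) (i : ι) :
    1 / 2 * (lam i * ∫ ω, ⟪v i, (1 / (N : ℝ)) •
        ∑ t ∈ Finset.range N, errIterate wstar γ 1 0 (fun t => Z t ω) t⟫_ℝ ^ 2 ∂P) ≤
      (1 - (1 - γ * lam i) ^ N) ^ 2 * (2 * σ2 / N) := by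
  have hpos := eigenvalue_pos hreg heig
  set q : ℕ → ι → ℝ := fun t i =>
    ∫ ω, ⟪v i, errIterate wstar γ 1 0 (fun t => Z t ω) t⟫_ℝ ^ 2 ∂P with hqdef
  have hq : ∀ t i, 0 ≤ q t i := fun t i => integral_nonneg fun ω => sq_nonneg _
  have hrec : ∀ t i, q (t + 1) i ≤ (1 - 2 * (γ * lam i)) * q t i
      + γ ^ 2 * α * lam i * ∑' j, lam j * q t j + γ ^ 2 * σ2 * lam i := fun t i => by
    simpa using integral_inner_errIterate_sq_succ_le (c := 1) (γ := γ) (e₀ := 0) hreg hnoise heig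
      hsum hα hZ hlaw hind (Or.inr rfl) t i
  have hqle := fun t => noise_moment_le (fun i => (hpos i).le) hsum hγ.le hα0 hγα hu hσ hq
    (fun i => by simp [hqdef, errIterate]) hrec t i
  have havg := integral_inner_avg_sq_le (c := 1) (e₀ := 0) hreg hnoise heig hZ hlaw hind hγ.le N i
  set A := ∫ ω, ⟪v i, (1 / (N : ℝ)) •
        ∑ t ∈ Finset.range N, errIterate wstar γ 1 0 (fun t => Z t ω) t⟫_ℝ ^ 2 ∂P
  set G := 1 - (1 - γ * lam i) ^ N
  have hl := hpos i
  have hui := hu i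
  have hul : 0 < γ * lam i := mul_pos hγ hl
  have hmono : ∀ s ≤ N, 0 ≤ 1 - (1 - γ * lam i) ^ s ∧ 1 - (1 - γ * lam i) ^ s ≤ G := fun s hs =>
    ⟨sub_nonneg.2 (pow_le_one₀ (by linarith) (by linarith)),
      sub_le_sub_left (pow_le_pow_of_le_one (by linarith) (by linarith) hs) _⟩
  have hN' : (0 : ℝ) < N := by exact_mod_cast hN
  -- One factor `G` bounds the weight and the other bounds the growth of `q s i`; both are monotone
  -- in time.
  have hW : ∑ s ∈ Finset.range N, (1 - (1 - γ * lam i) ^ (N - s)) * q s i ≤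
      N * (2 * γ * σ2 * G ^ 2) := by
    rw [← nsmul_eq_mul]
    conv_rhs => rw [← Finset.card_range N]
    refine Finset.sum_le_card_nsmul _ _ _ fun s hs => ?_
    have hs := (Finset.mem_range.1 hs).le
    calc _ ≤ G * (2 * γ * σ2 * G) := by
          refine mul_le_mul (hmono _ (Nat.sub_le _ _)).2 ((hqle s).trans ?_) (hq _ _)
            (hmono N le_rfl).1
          exact mul_le_mul_of_nonneg_left (hmono s hs).2 (by positivity)
      _ = _ := by ring
  calc 1 / 2 * (lam i * A) = 1 / (2 * γ) * (γ * lam i * A) := by field_simp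
    _ ≤ 1 / (2 * γ) * (2 / (N : ℝ) ^ 2 * (N * (2 * γ * σ2 * G ^ 2))) :=
      mul_le_mul_of_nonneg_left (havg.trans (mul_le_mul_of_nonneg_left hW (by positivity)))
        (by positivity)
    _ = _ := by field_simp

end ErrorRecursion

/-! ### Summation over the spectrum. -/

section Spectrum

variable {E : Type*} [NormedAddCommGroup E] [InnerProductSpace ℝ E]
  {d : ℕ∞} {v : HilbertBasis (Idx d) ℝ E} {lam : Idx d → ℝ}

/-- Splitting a spectral sum at the index `k`. -/
lemma spectral_sum_le (hpos : ∀ i, 0 < lam i) (hsum : Summable lam) {γ : ℝ} (hγ : 0 < γ)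
    (hu : ∀ i, γ * lam i ≤ 1 / 2) {N : ℕ} (hN : 0 < N) (k : ℕ) (w : E) {C : ℝ} (hC : 0 ≤ C)
    {f : Idx d → ℝ} {s : ℝ} (hf : HasSum f s)
    (hle : ∀ i, f i ≤ (1 - (1 - γ * lam i) ^ N) ^ 2 *
      (⟪v i, w⟫_ℝ ^ 2 / lam i / (γ * N) ^ 2 + C)) :
    s ≤ 1 / (γ * N) ^ 2 * headInvNormSq lam v k w + tailNormSq lam v k w
      + C * (k + (N * γ) ^ 2 * tailSqSum lam k) := by
  have hN' : (0 : ℝ) < N := by exact_mod_cast hN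
  set T := ∑' i, lam i
  have hlT : ∀ i, lam i ≤ T := fun i => hsum.le_tsum i fun j _ => (hpos j).le
  have hw : Summable fun i => ⟪v i, w⟫_ℝ ^ 2 :=
    (v.summable_inner_mul_inner w w).congr fun i => by rw [real_inner_comm, sq]
  have s1 := (summable_head (fun i => ⟪v i, w⟫_ℝ ^ 2 / lam i) k).hasSum
  have s2 := (summable_tail (f := fun i => lam i * ⟪v i, w⟫_ℝ ^ 2)
    (fun i => mul_nonneg (hpos i).le (sq_nonneg _))
    (Summable.of_nonneg_of_le (fun i => mul_nonneg (hpos i).le (sq_nonneg _))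
      (fun i => mul_le_mul_of_nonneg_right (hlT i) (sq_nonneg _)) (hw.mul_left T)) k).hasSum
  have s3 := (summable_head (fun _ : Idx d => (1 : ℝ)) k).hasSum
  have s4 := (summable_tail (f := fun i => lam i ^ 2) (fun i => sq_nonneg _)
    (Summable.of_nonneg_of_le (fun i => sq_nonneg _)
      (fun i => by rw [sq]; exact mul_le_mul_of_nonneg_right (hlT i) (hpos i).le)
      (hsum.mul_left T)) k).hasSum
  have hS := ((s1.mul_left (1 / (γ * N) ^ 2)).add s2).add
    ((s3.add (s4.mul_left ((N * γ) ^ 2))).mul_left C)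
  refine (hasSum_le (fun i => ?_) hf hS).trans ?_
  · refine (hle i).trans ?_
    have hl := hpos i
    have hui := hu i
    have hul : 0 < γ * lam i := mul_pos hγ hl
    have h0 : 0 ≤ 1 - (1 - γ * lam i) ^ N :=
      sub_nonneg.2 (pow_le_one₀ (by linarith) (by linarith))
    have h1 : 1 - (1 - γ * lam i) ^ N ≤ 1 := sub_le_self _ (pow_nonneg (by linarith) _)
    have h2 := one_sub_pow_le_mul (show γ * lam i ≤ 1 by linarith) N
    have hb : 0 ≤ ⟪v i, w⟫_ℝ ^ 2 / lam i / (γ * N) ^ 2 + C := by positivity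
    -- Head indices use `1 - (1 - u)^N ≤ 1`. Tail indices use Bernoulli's `N u`, whose square
    -- cancels `(γ N)²` and turns `1/λ_i` into `λ_i`.
    split_ifs
    · calc _ ≤ 1 * (⟪v i, w⟫_ℝ ^ 2 / lam i / (γ * N) ^ 2 + C) :=
            mul_le_mul_of_nonneg_right (pow_le_one₀ h0 h1) hb
        _ = _ := by ring
    · calc _ ≤ (N * (γ * lam i)) ^ 2 * (⟪v i, w⟫_ℝ ^ 2 / lam i / (γ * N) ^ 2 + C) :=
            mul_le_mul_of_nonneg_right (pow_le_pow_left₀ h0 h2 2) hb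
        _ = _ := by field_simp; ring
  · rw [headInvNormSq, tailNormSq, tailSqSum]
    have := mul_le_mul_of_nonneg_left (tsum_head_one_le (d := d) k) hC
    linarith

end Spectrum

/-! ### Assembly of the excess risk bound. -/

section ExcessRisk

variable {E : Type*} [NormedAddCommGroup E] [InnerProductSpace ℝ E] [CompleteSpace E]
  [SecondCountableTopology E] [MeasurableSpace E] [BorelSpace E]
  {D : Measure (E × ℝ)} [IsProbabilityMeasure D] {wstar : E}
  {Ω : Type*} [MeasurableSpace Ω] {P : Measure Ω} [IsProbabilityMeasure P]

lemma inner_secondMoment_nonneg (hreg : Regularity D wstar) (u : E) :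
    0 ≤ ⟪u, secondMoment D u⟫_ℝ := by
  rcases eq_or_ne u 0 with rfl | hu
  · simp
  · exact (hreg.posDef u hu).le

/-- The difference of the two sides is the quadratic form at `a - b`. This is the source of the
factor 2 in the theorem. -/
lemma inner_secondMoment_add_le (hreg : Regularity D wstar) (a b : E) :
    ⟪a + b, secondMoment D (a + b)⟫_ℝ ≤
      2 * ⟪a, secondMoment D a⟫_ℝ + 2 * ⟪b, secondMoment D b⟫_ℝ := by
  have h := inner_secondMoment_nonneg hreg (a - b)
  simp only [map_add, map_sub, inner_add_left, inner_add_right, inner_sub_left,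
    inner_sub_right] at h ⊢
  linarith

lemma integrable_inner_secondMoment_add (hreg : Regularity D wstar) {a b : Ω → E}
    (ha : Measurable a) (hb : Measurable b) (ha2 : Integrable (fun ω => ‖a ω‖ ^ 2) P)
    (hb2 : Integrable (fun ω => ‖b ω‖ ^ 2) P) :
    Integrable (fun ω => ⟪a ω + b ω, secondMoment D (a ω + b ω)⟫_ℝ) P := by
  refine (((integrable_inner_secondMoment (D := D) ha ha2).const_mul 2).add
    ((integrable_inner_secondMoment (D := D) hb hb2).const_mul 2)).mono'
    ((ha.add hb).inner ((secondMoment D).measurable.comp (ha.add hb))).aestronglyMeasurable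
    (Filter.Eventually.of_forall fun ω => ?_)
  rw [Real.norm_of_nonneg (inner_secondMoment_nonneg hreg _)]
  exact inner_secondMoment_add_le hreg _ _

lemma subsingleton_of_isEmpty {ι : Type*} [IsEmpty ι] (v : HilbertBasis ι ℝ E) :
    Subsingleton E := by
  refine subsingleton_of_forall_eq 0 fun x => ?_
  have h := v.tsum_inner_mul_inner x x
  rw [tsum_empty] at h
  exact inner_self_eq_zero.1 h.symm

/-- The excess risk bound when the eigenbasis is non-empty and the examples are measurable. -/
lemma excess_risk_le (hreg : Regularity D wstar) {d : ℕ∞} {lam : Idx d → ℝ}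
    {v : HilbertBasis (Idx d) ℝ E}
    (heig : IsSortedEigendecomposition (secondMoment D) lam v) [Nonempty (Idx d)]
    {α : ℝ} (hα : 0 < α) (hfourth : FourthMomentCondition D v α)
    {sigmaSq : ℝ} (hnoise : NoiseCondition D wstar sigmaSq)
    {Z : ℕ → Ω → E × ℝ} (hZ : ∀ t, Measurable (Z t)) (hlaw : ∀ t, P.map (Z t) = D)
    (hindep : iIndepFun Z P) {N : ℕ} (hN : 0 < N) (w0 : E) {γ : ℝ}
    (hγ : γ = 1 / (2 * α * ∑' i, lam i)) (k : ℕ) :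
    Integrable (fun ω => risk D (averagedIterate γ w0 (fun t => Z t ω) N)) P ∧
      (∫ ω, risk D (averagedIterate γ w0 (fun t => Z t ω) N) ∂P) - risk D wstar ≤
        2 * effectiveBias α lam v (w0 - wstar) N k
          + 2 * effectiveVar α sigmaSq lam (w0 - wstar) N k := by
  have hpos := eigenvalue_pos hreg heig.apply_eq
  have hsum := heig.summable
  have hσ : 0 ≤ sigmaSq := by
    obtain ⟨R, S, -, -, -, rfl⟩ := hnoise.norm_eq
    exact norm_nonneg S
  have hlT : ∀ i, lam i ≤ ∑' i, lam i := fun i => hsum.le_tsum i fun j _ => (hpos j).le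
  set T := ∑' i, lam i with hT
  have hT0 : 0 < T := (hpos (Classical.arbitrary _)).trans_le (hlT _)
  have hγ0 : 0 < γ := by rw [hγ]; positivity
  have hγα : γ * α * T = 1 / 2 := by rw [hγ]; field_simp
  have hα1 := one_le_of_fourthMomentCondition hreg heig.apply_eq hfourth (Classical.arbitrary _)
  -- Since `λ_i ≤ tr H` and `α ≥ 1`, `γ λ_i ≤ γ α tr H = 1/2`.
  have hu : ∀ i, γ * lam i ≤ 1 / 2 := fun i => by
    have h1 := mul_le_mul_of_nonneg_left (hlT i) hγ0.le
    have h2 : γ * T * 1 ≤ γ * T * α := mul_le_mul_of_nonneg_left hα1 (by positivity)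
    linarith
  set a : Ω → E := fun ω => (1 / (N : ℝ)) •
    ∑ t ∈ Finset.range N, errIterate wstar γ 0 (w0 - wstar) (fun t => Z t ω) t
  set b : Ω → E := fun ω => (1 / (N : ℝ)) •
    ∑ t ∈ Finset.range N, errIterate wstar γ 1 0 (fun t => Z t ω) t
  have ha : Measurable a :=
    (Finset.measurable_fun_sum _ fun t _ => measurable_errIterate hZ t).const_smul _
  have hb : Measurable b :=
    (Finset.measurable_fun_sum _ fun t _ => measurable_errIterate hZ t).const_smul _
  have ha2 : Integrable (fun ω => ‖a ω‖ ^ 2) P :=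
    integrable_norm_avg_sq hreg hnoise hZ hlaw hindep N
  have hb2 : Integrable (fun ω => ‖b ω‖ ^ 2) P :=
    integrable_norm_avg_sq hreg hnoise hZ hlaw hindep N
  have hrisk : ∀ ω, risk D (averagedIterate γ w0 (fun t => Z t ω) N) =
      risk D wstar + 1 / 2 * ⟪a ω + b ω, secondMoment D (a ω + b ω)⟫_ℝ := fun ω => by
    rw [risk_eq hreg, averagedIterate_sub wstar γ w0 _ hN]
  simp_rw [hrisk]
  have hab := integrable_inner_secondMoment_add hreg ha hb ha2 hb2
  refine ⟨(integrable_const _).add (hab.const_mul _), ?_⟩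
  rw [integral_add (integrable_const _) (hab.const_mul _), integral_const_mul, integral_const,
    probReal_univ, one_smul, add_sub_cancel_left]
  have iA := integrable_inner_secondMoment (D := D) ha ha2
  have iB := integrable_inner_secondMoment (D := D) hb hb2
  have hsplit : ∫ ω, ⟪a ω + b ω, secondMoment D (a ω + b ω)⟫_ℝ ∂P ≤
      2 * ∫ ω, ⟪a ω, secondMoment D (a ω)⟫_ℝ ∂P
        + 2 * ∫ ω, ⟪b ω, secondMoment D (b ω)⟫_ℝ ∂P := by
    rw [← integral_const_mul, ← integral_const_mul,
      ← integral_add (iA.const_mul 2) (iB.const_mul 2)]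
    exact integral_mono hab ((iA.const_mul 2).add (iB.const_mul 2)) fun ω =>
      inner_secondMoment_add_le hreg _ _
  have hA := spectral_sum_le hpos hsum hγ0 hu hN k (w0 - wstar)
    (C := α * ‖w0 - wstar‖ ^ 2 / (2 * γ * N ^ 2)) (by positivity)
    ((hasSum_integral_inner_sq hreg heig.apply_eq hsum ha ha2).mul_left (1 / 2))
    fun i => bias_coordinate_le hreg hnoise heig.apply_eq hsum hα.le hfourth hZ hlaw hindep
      hγ0 hγα hu hN i
  -- The noise run starts at zero, so the splitting is applied with `w = 0` and only the constant
  -- `C` survives.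
  have hB := spectral_sum_le (v := v) hpos hsum hγ0 hu hN k 0 (C := 2 * sigmaSq / N) (by positivity)
    ((hasSum_integral_inner_sq hreg heig.apply_eq hsum hb hb2).mul_left (1 / 2))
    fun i => by
      rw [inner_zero_right, sq (0 : ℝ), zero_mul, zero_div, zero_div, zero_add]
      exact noise_coordinate_le hreg hσ hnoise heig.apply_eq hsum hα.le hfourth hZ hlaw
        hindep hγ0 hγα hu hN i
  have hN' : (0 : ℝ) < N := by exact_mod_cast hN
  have hh0 : headInvNormSq lam v k (0 : E) = 0 := by simp [headInvNormSq]
  have ht0 : tailNormSq lam v k (0 : E) = 0 := by simp [tailNormSq]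
  have e1 : 1 / (γ * N) ^ 2 = 4 * α ^ 2 * T ^ 2 / (N : ℝ) ^ 2 := by rw [hγ]; field_simp; norm_num
  have e2 : α * ‖w0 - wstar‖ ^ 2 / (2 * γ * N ^ 2) =
      α ^ 2 * T * ‖w0 - wstar‖ ^ 2 / N ^ 2 := by rw [hγ]; field_simp
  have e3 : (N * γ) ^ 2 = (N : ℝ) ^ 2 / (4 * α ^ 2 * T ^ 2) := by rw [hγ]; field_simp; norm_num
  rw [hh0, ht0] at hB
  rw [e1, e2, e3] at hA
  rw [e3] at hB
  have hVar : effectiveVar α sigmaSq lam (w0 - wstar) N k =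
      α ^ 2 * T * ‖w0 - wstar‖ ^ 2 / N ^ 2 * (k + N ^ 2 / (4 * α ^ 2 * T ^ 2) * tailSqSum lam k)
      + 2 * sigmaSq / N * (k + N ^ 2 / (4 * α ^ 2 * T ^ 2) * tailSqSum lam k) := by
    rw [effectiveVar, ← hT]; field_simp; ring
  rw [hVar, effectiveBias, ← hT]
  linarith

/-- An empty eigenbasis forces a one-point space: the excess risk is zero and the right side is
nonnegative. The trace is then zero, so the choice of stepsize carries no information and this case
must be treated apart. -/
lemma excess_risk_le_of_isEmpty {d : ℕ∞} {lam : Idx d → ℝ}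
    {v : HilbertBasis (Idx d) ℝ E} [IsEmpty (Idx d)] {α sigmaSq : ℝ} (hσ : 0 ≤ sigmaSq)
    (w : Ω → E) (u : E) (N k : ℕ) :
    Integrable (fun ω => risk D (w ω)) P ∧
      (∫ ω, risk D (w ω) ∂P) - risk D wstar ≤
        2 * effectiveBias α lam v u N k + 2 * effectiveVar α sigmaSq lam u N k := by
  have := subsingleton_of_isEmpty v
  have hw : ∀ ω, w ω = wstar := fun ω => Subsingleton.elim _ _
  simp_rw [hw]
  refine ⟨integrable_const _, ?_⟩
  simp only [integral_const, probReal_univ, one_smul, sub_self, effectiveBias, effectiveVar,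
    headInvNormSq, tailNormSq, tailSqSum, tsum_empty]
  simp only [mul_zero, zero_mul, zero_div, add_zero, zero_add]
  positivity

end ExcessRisk

end LinRegSGD

/-! ### The theorem for general samples and dimension. -/

theorem corollary2p1
    {E : Type*} [NormedAddCommGroup E] [InnerProductSpace ℝ E] [CompleteSpace E]
    [SecondCountableTopology E] [MeasurableSpace E] [BorelSpace E]
    -- the data distribution and the minimizer of the risk
    (D : Measure (E × ℝ)) [IsProbabilityMeasure D] (wstar : E)
    (hreg : LinRegSGD.Regularity D wstar)
    -- the eigenvalues and eigenvectors of the second moment operator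
    {d : ℕ∞} (lam : LinRegSGD.Idx d → ℝ) (v : HilbertBasis (LinRegSGD.Idx d) ℝ E)
    (heig : LinRegSGD.IsSortedEigendecomposition (LinRegSGD.secondMoment D) lam v)
    -- the fourth moment condition and the noise condition
    (α : ℝ) (hα : 0 < α) (hfourth : LinRegSGD.FourthMomentCondition D v α)
    (sigmaSq : ℝ) (hnoise : LinRegSGD.NoiseCondition D wstar sigmaSq)
    -- i.i.d. examples with law `D`
    {Ω : Type*} [MeasurableSpace Ω] (P : Measure Ω) [IsProbabilityMeasure P]
    (Z : ℕ → Ω → E × ℝ) (hlaw : ∀ t, HasLaw (Z t) D P) (hindep : iIndepFun Z P)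
    -- sample size, initialization, stepsize, effective dimension
    (N : ℕ) (hN : 0 < N) (w0 : E)
    (γ : ℝ) (hγ : γ = 1 / (2 * α * ∑' i, lam i))
    (k : ℕ) (hk : k = LinRegSGD.effectiveDim lam (2 * α * (∑' i, lam i) / N)) :
    Integrable (fun ω => LinRegSGD.risk D
        (LinRegSGD.averagedIterate γ w0 (fun t => Z t ω) N)) P ∧
      (∫ ω, LinRegSGD.risk D (LinRegSGD.averagedIterate γ w0 (fun t => Z t ω) N) ∂P)
          - LinRegSGD.risk D wstar ≤
        2 * LinRegSGD.effectiveBias α lam v (w0 - wstar) N k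
          + 2 * LinRegSGD.effectiveVar α sigmaSq lam (w0 - wstar) N k := by
  have hσ : 0 ≤ sigmaSq := by
    obtain ⟨R, S, -, -, -, rfl⟩ := hnoise.norm_eq
    exact norm_nonneg S
  rcases isEmpty_or_nonempty (LinRegSGD.Idx d) with hd | hd
  · exact LinRegSGD.excess_risk_le_of_isEmpty hσ _ _ N k
  have hZ := fun t => (hlaw t).aemeasurable
  -- `HasLaw` gives only a.e. measurability. There are countably many examples, so replacing all of
  -- them by measurable versions changes the whole stream on a null set only.
  have hae : ∀ᵐ ω ∂P, (fun t => Z t ω) = fun t => (hZ t).mk (Z t) ω := by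
    filter_upwards [ae_all_iff.2 fun t => (hZ t).ae_eq_mk] with ω h
    exact funext h
  have h := LinRegSGD.excess_risk_le hreg heig hα hfourth hnoise (P := P)
    (fun t => (hZ t).measurable_mk)
    (fun t => by rw [← Measure.map_congr (hZ t).ae_eq_mk, (hlaw t).map_eq])
    (hindep.congr fun t => (hZ t).ae_eq_mk) hN w0 hγ k
  have hr : (fun ω => LinRegSGD.risk D (LinRegSGD.averagedIterate γ w0 (fun t => Z t ω) N)) =ᵐ[P]
      fun ω => LinRegSGD.risk D
        (LinRegSGD.averagedIterate γ w0 (fun t => (hZ t).mk (Z t) ω) N) := by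
    filter_upwards [hae] with ω h
    rw [h]
  exact ⟨h.1.congr hr.symm, by rw [integral_congr_ae hr]; exact h.2⟩
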